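/- All vector spaces are finite-dimensional and real. A linear $2$-groupoid is a simplicial vector space $V_\bullet$, with faces $f_i$ and degeneracies $\sigma_i$, whose horn maps $\lambda_{q,k}\colon V_q\to\Lambda_{q,k}V$ are surjective for $q\ge 1$ and bijective for $q>2$. A constant symplectic $2$-groupoid is a linear $2$-groupoid $V_\bullet$ with an alternating bilinear form $\omega$ on $V_2$ (a constant, hence closed, $2$-form) that is - multiplicative: $\sum_{i=0}^{3}(-1)^i f_i^*\omega=0$ on $V_3$; - normalized: $\sigma_0^*\omega=\sigma_1^*\omega=0$ on $V_1$; - simplicially nondegenerate: the pairing of $V_0$ with $V_2/(\sigma_0V_1+\sigma_1V_1)$ induced by $A_\omega(v,w)=\omega(\sigma_0\sigma_0v,w)$ and the symmetric form on $V_1/\sigma_0V_0$ induced by $B_\omega(\theta,\eta)=\omega(\sigma_1\theta,\sigma_0\eta)+\omega(\sigma_1\eta,\sigma_0\theta)$ are nondegenerate. Its associated complex is $W_2\xrightarrow{\partial_2}W_1\xrightarrow{\partial_1}W_0$ with $W_0=V_0$, $W_1=\ker (f_0\colon V_1\to V_0)$, $W_2=\ker (f_0,f_1)\subseteq V_2$,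 $\partial_1=-f_1$, $\partial_2=f_2$. Identify $W_2\oplus W_1\oplus W_1\oplus W_0$ with $V_2$ by $$(w_2,w_1,w_1',w_0)\mapsto w_2+\sigma_0(w_1+\sigma_0w_0)+\sigma_1(w_1'-w_1),$$ and put $C_{41}(w_0,w_2)=\omega((0,0,0,w_0),(w_2,0,0,0))$ and $C_{32}(w,w')=\omega((0,0,w,0),(0,w',0,0))$. **Theorem 3.5.** Constant symplectic $2$-groupoids are in one-to-one correspondence with tuples $(W_1,W_0,\langle\cdot,\cdot\rangle,\partial,r)$, where $W_1,W_0$ are vector spaces, $\langle\cdot,\cdot\rangle$ is a nondegenerate symmetric bilinear form on $W_1$, $\partial\colon W_1\to W_0$ is a linear map such that the image of $\partial^*\colon W_0^*\to W_1^*\cong W_1$ is isotropic, and $r\in\wedge^2W_1^*$. Here a constant symplectic $2$-groupoid corresponds to a tuple if there is an isomorphism (a *presentation*) of its associated complex with $$W_0^*\xrightarrow{\partial^*}W_1\xrightarrow{\partial}W_0$$ that carries $C_{41}$ to the canonical pairing of $W_0$ with $W_0^*$ and $C_{32}$ to $\tfrac12\langle\cdot,\cdot\rangle+r$. Precisely: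 1. This relation is the graph of a bijection from isomorphism classes of constant symplectic $2$-groupoids (isomorphisms of simplicial vector spaces preserving $\omega$) to isomorphism classes of tuples (pairs of linear isomorphisms of $W_1$ and of $W_0$ preserving $\langle\cdot,\cdot\rangle$, $\partial$ and $r$). 2. Given presentations of $X$ by $S$ and of $Y$ by $T$, every isomorphism $S\to T$ is induced by exactly one isomorphism $X\to Y$, and every isomorphism $X\to Y$ induces exactly one isomorphism $S\to T$; here "induces" means that the two agree on $W_0$ and $W_1$ under the presentations. -/

import Mathlib

open CategoryTheory Opposite
open scoped Simplicial

universe u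

namespace ConstSymplectic

/-! ### Simplicial vector spaces and linear `n`-groupoids -/

/-- Simplicial real vector spaces. -/
abbrev SimplicialVS : Type (u + 1) := SimplicialObject (ModuleCat.{u} ℝ)

/-- The face map `f_i : V_{q+1} → V_q`. -/
abbrev face (V : SimplicialVS.{u}) {q : ℕ} (i : Fin (q + 2)) : V _⦋q + 1⦌ →ₗ[ℝ] V _⦋q⦌ :=
  (V.δ i).hom

/-- The degeneracy map `σ_i : V_q → V_{q+1}`. -/
abbrev degen (V : SimplicialVS.{u}) {q : ℕ} (i : Fin (q + 1)) : V _⦋q⦌ →ₗ[ℝ] V _⦋q + 1⦌ :=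
  (V.σ i).hom

/-- The horn compatibility equations for a tuple `(x_i)_{i ≠ k}` of elements of `V_q`, i.e. for a
`(q + 1, k)`-horn: `f_a x_b = f_{b-1} x_a` for all `a < b` different from `k`.  Below `a` is
`i.castSucc` and `b` is `j.succ`, so that `a < b` says `i ≤ j`.  There is no equation if `q = 0`. -/
def IsHorn (V : SimplicialVS.{u}) (q : ℕ) (k : Fin (q + 2))
    (x : {i : Fin (q + 2) // i ≠ k} → V _⦋q⦌) : Prop :=
  match q, k, x with
  | 0, _, _ => True
  | m + 1, k, x => ∀ (i j : Fin (m + 2)) (hi : i.castSucc ≠ k) (hj : j.succ ≠ k), i ≤ j →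
      face V i (x ⟨j.succ, hj⟩) = face V j (x ⟨i.castSucc, hi⟩)

/-- A linear `n`-groupoid: a Lie `n`-groupoid all of whose levels are (finite-dimensional) vector
spaces and all of whose structure maps are linear.  The horn maps
`x ↦ (f_i x)_{i ≠ k}` from `V_{q+1}` to the space of `(q + 1, k)`-horns are linear, so they are
surjective submersions as soon as they are surjective, and diffeomorphisms as soon as they are
bijective.  (Faces are surjective, hence submersions, and degeneracies are injective, hence
embeddings, because of the simplicial identities.) -/
structure IsLinearGroupoid (n : ℕ) (V : SimplicialVS.{u}) : Prop where
  finiteDimensional : ∀ q : ℕ, FiniteDimensional ℝ (V _⦋q⦌)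
  horn_surjective : ∀ (q : ℕ) (k : Fin (q + 2)) (x : {i : Fin (q + 2) // i ≠ k} → V _⦋q⦌),
    IsHorn V q k x → ∃ y : V _⦋q + 1⦌, ∀ i, face V i.1 y = x i
  horn_bijective : ∀ q : ℕ, n < q + 1 → ∀ (k : Fin (q + 2))
    (x : {i : Fin (q + 2) // i ≠ k} → V _⦋q⦌),
    IsHorn V q k x → ∃! y : V _⦋q + 1⦌, ∀ i, face V i.1 y = x i

/-! ### Constant 2-forms

A constant 2-form on a vector space is an alternating bilinear form.  It is automatically closed,
and pulling it back along a linear map is composing it with the map in both arguments. -/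

/-- The simplicial coboundary `δ ω = ∑ i, (-1)^i f_i^* ω`. -/
noncomputable def coboundary (V : SimplicialVS.{u}) {q : ℕ} (ω : LinearMap.BilinForm ℝ (V _⦋q⦌)) :
    LinearMap.BilinForm ℝ (V _⦋q + 1⦌) :=
  ∑ i : Fin (q + 2), (-1 : ℝ) ^ (i : ℕ) • LinearMap.BilinForm.comp ω (face V i) (face V i)

/-- `ω` is multiplicative if `δ ω = 0`. -/
def IsMultiplicative (V : SimplicialVS.{u}) {q : ℕ} (ω : LinearMap.BilinForm ℝ (V _⦋q⦌)) : Prop :=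
  coboundary V ω = 0

/-- `ω` is normalized if its pullbacks along all degeneracies vanish. -/
def IsNormalized (V : SimplicialVS.{u}) {q : ℕ} (ω : LinearMap.BilinForm ℝ (V _⦋q + 1⦌)) : Prop :=
  ∀ i : Fin (q + 1), LinearMap.BilinForm.comp ω (degen V i) (degen V i) = 0

/-- The sum of the degenerate subspaces of `V_{q+1}`. -/
def degenerate (V : SimplicialVS.{u}) (q : ℕ) : Submodule ℝ (V _⦋q + 1⦌) :=
  ⨆ i : Fin (q + 1), LinearMap.range (degen V i)

/-- The normalized tangent space in degree `q + 1`.  (The tangent space of a vector space at each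
of its points is the vector space itself.)  In degree `0` the normalized tangent space is `V_0`. -/
abbrev NormalizedTangent (V : SimplicialVS.{u}) (q : ℕ) : Type u :=
  V _⦋q + 1⦌ ⧸ degenerate V q

/-- The map `σ_0 σ_0 : V_0 → V_2`. -/
def unitMap (V : SimplicialVS.{u}) : V _⦋0⦌ →ₗ[ℝ] V _⦋2⦌ :=
  degen V (q := 1) 0 ∘ₗ degen V (q := 0) 0

/-- `Ã_ω (v, w) = ω (σ_0 σ_0 v, w)`, for `v ∈ V_0` and `w ∈ V_2`. -/
def preA (V : SimplicialVS.{u}) (ω : LinearMap.BilinForm ℝ (V _⦋2⦌)) :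
    V _⦋0⦌ →ₗ[ℝ] V _⦋2⦌ →ₗ[ℝ] ℝ :=
  ω ∘ₗ unitMap V

/-- `B̃_ω (θ, η) = ω (σ_1 θ, σ_0 η) + ω (σ_1 η, σ_0 θ)`, for `θ, η ∈ V_1`. -/
def preB (V : SimplicialVS.{u}) (ω : LinearMap.BilinForm ℝ (V _⦋2⦌)) :
    V _⦋1⦌ →ₗ[ℝ] V _⦋1⦌ →ₗ[ℝ] ℝ :=
  ω.compl₁₂ (degen V (q := 1) 1) (degen V (q := 1) 0)
    + (ω.compl₁₂ (degen V (q := 1) 1) (degen V (q := 1) 0)).flip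

theorem degen_degen (V : SimplicialVS.{u}) (v : V _⦋0⦌) :
    degen V (q := 1) 1 (degen V (q := 0) 0 v) = degen V (q := 1) 0 (degen V (q := 0) 0 v) := by
  have h := V.σ_comp_σ (n := 0) (i := 0) (j := 0) le_rfl
  have h' := congrArg (fun f => f.hom v) h
  exact h'.symm

theorem IsNormalized.apply {V : SimplicialVS.{u}} {ω : LinearMap.BilinForm ℝ (V _⦋2⦌)}
    (h : IsNormalized V (q := 1) ω) (i : Fin 2) (x y : V _⦋1⦌) :
    ω (degen V (q := 1) i x) (degen V (q := 1) i y) = 0 :=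
  congrArg (fun b : LinearMap.BilinForm ℝ (V _⦋1⦌) => b x y) (h i)

theorem preA_degenerate {V : SimplicialVS.{u}} {ω : LinearMap.BilinForm ℝ (V _⦋2⦌)}
    (h : IsNormalized V (q := 1) ω) : degenerate V 1 ≤ LinearMap.ker (preA V ω).flip := by
  refine iSup_le fun i => ?_
  rintro _ ⟨y, rfl⟩
  rw [LinearMap.mem_ker]
  ext v
  change ω (degen V (q := 1) 0 (degen V (q := 0) 0 v)) (degen V (q := 1) i y) = 0
  fin_cases i
  · exact h.apply 0 _ _
  · rw [← degen_degen]
    exact h.apply 1 _ _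

theorem preB_degenerate {V : SimplicialVS.{u}} {ω : LinearMap.BilinForm ℝ (V _⦋2⦌)}
    (h : IsNormalized V (q := 1) ω) : degenerate V 0 ≤ LinearMap.ker (preB V ω) := by
  refine iSup_le fun i => ?_
  rintro _ ⟨v, rfl⟩
  rw [LinearMap.mem_ker]
  ext η
  fin_cases i
  change ω (degen V (q := 1) 1 (degen V (q := 0) 0 v)) (degen V (q := 1) 0 η)
    + ω (degen V (q := 1) 1 η) (degen V (q := 1) 0 (degen V (q := 0) 0 v)) = 0
  rw [← degen_degen, h.apply 1, degen_degen, h.apply 0, add_zero]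

theorem preB_flip {V : SimplicialVS.{u}} (ω : LinearMap.BilinForm ℝ (V _⦋2⦌)) :
    (preB V ω).flip = preB V ω := by
  ext x y
  exact add_comm _ _

/-- The pairing `A_ω` between `V_0` and the normalized tangent space in degree `2`. -/
def pairingA (V : SimplicialVS.{u}) (ω : LinearMap.BilinForm ℝ (V _⦋2⦌))
    (h : IsNormalized V (q := 1) ω) : V _⦋0⦌ →ₗ[ℝ] NormalizedTangent V 1 →ₗ[ℝ] ℝ :=
  ((degenerate V 1).liftQ (preA V ω).flip (preA_degenerate h)).flip

/-- The form `B_ω` on the normalized tangent space in degree `1`. -/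
def pairingB (V : SimplicialVS.{u}) (ω : LinearMap.BilinForm ℝ (V _⦋2⦌))
    (h : IsNormalized V (q := 1) ω) :
    NormalizedTangent V 0 →ₗ[ℝ] NormalizedTangent V 0 →ₗ[ℝ] ℝ :=
  (degenerate V 0).liftQ
    ((degenerate V 0).liftQ (preB V ω) (preB_degenerate h)).flip
    (by
      intro x hx
      rw [LinearMap.mem_ker]
      ext y
      have hx' := preB_degenerate h hx
      rw [LinearMap.mem_ker, ← preB_flip] at hx'
      exact congrArg (fun f : V _⦋1⦌ →ₗ[ℝ] ℝ => f y) hx')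

theorem pairingA_mk (V : SimplicialVS.{u}) (ω : LinearMap.BilinForm ℝ (V _⦋2⦌))
    (h : IsNormalized V (q := 1) ω) (v : V _⦋0⦌) (w : V _⦋2⦌) :
    pairingA V ω h v (Submodule.Quotient.mk w)
      = ω (degen V (q := 1) 0 (degen V (q := 0) 0 v)) w := rfl

theorem pairingB_mk (V : SimplicialVS.{u}) (ω : LinearMap.BilinForm ℝ (V _⦋2⦌))
    (h : IsNormalized V (q := 1) ω) (θ η : V _⦋1⦌) :
    pairingB V ω h (Submodule.Quotient.mk θ) (Submodule.Quotient.mk η)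
      = ω (degen V (q := 1) 1 θ) (degen V (q := 1) 0 η)
        + ω (degen V (q := 1) 1 η) (degen V (q := 1) 0 θ) :=
  add_comm _ _

/-! ### Constant symplectic 2-groupoids -/

/-- A constant symplectic 2-groupoid: a linear 2-groupoid with a constant (hence closed)
multiplicative, normalized and simplicially nondegenerate 2-form on `V_2`. -/
structure ConstSymp2Groupoid : Type (u + 1) where
  V : SimplicialVS.{u}
  isLinearGroupoid : IsLinearGroupoid 2 V
  ω : LinearMap.BilinForm ℝ (V _⦋2⦌)
  isAlt : ω.IsAlt
  isMultiplicative : IsMultiplicative V (q := 2) ω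
  isNormalized : IsNormalized V (q := 1) ω
  nondegenerate_A : (pairingA V ω isNormalized).Nondegenerate
  nondegenerate_B : (pairingB V ω isNormalized).Nondegenerate

/-- An isomorphism of constant symplectic 2-groupoids: an isomorphism of simplicial vector spaces
that preserves the 2-forms. -/
@[ext]
structure SympIso (X Y : ConstSymp2Groupoid.{u}) where
  iso : X.V ≅ Y.V
  map_ω : ∀ x y : X.V _⦋2⦌,
    Y.ω ((iso.hom.app (op ⦋2⦌)).hom x) ((iso.hom.app (op ⦋2⦌)).hom y) = X.ω x y

/-- The component in degree `q` of an isomorphism. -/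
abbrev SympIso.app {X Y : ConstSymp2Groupoid.{u}} (f : SympIso X Y) (q : ℕ) :
    X.V _⦋q⦌ →ₗ[ℝ] Y.V _⦋q⦌ :=
  (f.iso.hom.app (op ⦋q⦌)).hom

/-- Constant symplectic 2-groupoids up to isomorphism. -/
def sympSetoid : Setoid ConstSymp2Groupoid.{u} where
  r X Y := Nonempty (SympIso X Y)
  iseqv :=
    { refl := fun X => ⟨⟨Iso.refl _, fun _ _ => rfl⟩⟩
      symm := by
        rintro X Y ⟨f⟩
        refine ⟨⟨f.iso.symm, fun x y => ?_⟩⟩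
        have key : ∀ z : Y.V _⦋2⦌,
            (f.iso.hom.app (op ⦋2⦌)).hom ((f.iso.inv.app (op ⦋2⦌)).hom z) = z := fun z =>
          congrArg (fun g => g.hom z) (f.iso.inv_hom_id_app (op ⦋2⦌))
        have := f.map_ω ((f.iso.inv.app (op ⦋2⦌)).hom x) ((f.iso.inv.app (op ⦋2⦌)).hom y)
        rw [key, key] at this
        exact this.symm
      trans := by
        rintro X Y Z ⟨f⟩ ⟨g⟩
        exact ⟨⟨f.iso ≪≫ g.iso, fun x y => (g.map_ω _ _).trans (f.map_ω x y)⟩⟩ }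

/-! ### The associated 3-term complex and the forms `C₄₁`, `C₃₂` -/

/-- `W_0 = V_0`. -/
abbrev cplx0 (V : SimplicialVS.{u}) : Type u := V _⦋0⦌

/-- `W_1 = ker f_0 ⊆ V_1`. -/
def cplx1 (V : SimplicialVS.{u}) : Submodule ℝ (V _⦋1⦌) :=
  LinearMap.ker (face V (q := 0) 0)

/-- `W_2`, the kernel of the horn map `(f_0, f_1)` on `V_2`. -/
def cplx2 (V : SimplicialVS.{u}) : Submodule ℝ (V _⦋2⦌) :=
  LinearMap.ker (face V (q := 1) 0) ⊓ LinearMap.ker (face V (q := 1) 1)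

/-- `∂_1 = - f_1 : W_1 → W_0`. -/
def bdry1 (V : SimplicialVS.{u}) : cplx1 V →ₗ[ℝ] cplx0 V :=
  -(face V (q := 0) 1 ∘ₗ (cplx1 V).subtype)

theorem face_two_mem (V : SimplicialVS.{u}) (w : cplx2 V) : face V (q := 1) 2 w.1 ∈ cplx1 V := by
  have h := V.δ_comp_δ (n := 0) (i := 0) (j := 1) (by decide)
  have h' : face V (q := 0) 0 (face V (q := 1) 2 w.1)
      = face V (q := 0) 1 (face V (q := 1) 0 w.1) := congrArg (fun f => f.hom w.1) h
  have h0 : face V (q := 1) 0 w.1 = 0 := w.2.1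
  change face V (q := 0) 0 (face V (q := 1) 2 w.1) = 0
  rw [h', h0, map_zero]

/-- `∂_2 = f_2 : W_2 → W_1`. -/
def bdry2 (V : SimplicialVS.{u}) : cplx2 V →ₗ[ℝ] cplx1 V :=
  (face V (q := 1) 2 ∘ₗ (cplx2 V).subtype).codRestrict (cplx1 V) (face_two_mem V)

/-- The identification of `W_2 ⊕ W_1 ⊕ W_1 ⊕ W_0` with `V_2`: with `v = w_1 + σ_0 w_0` and
`v' = w_1' + σ_0 w_0` in `V_1`, it sends `(w_2, w_1, w_1', w_0)` to
`w_2 + σ_0 v + σ_1 (v' - v)`. -/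
def assemble (V : SimplicialVS.{u}) (w₂ : cplx2 V) (w₁ w₁' : cplx1 V) (w₀ : cplx0 V) : V _⦋2⦌ :=
  (w₂ : V _⦋2⦌)
    + degen V (q := 1) 0 ((w₁ : V _⦋1⦌) + degen V (q := 0) 0 w₀)
    + degen V (q := 1) 1 (((w₁' : V _⦋1⦌) + degen V (q := 0) 0 w₀)
        - ((w₁ : V _⦋1⦌) + degen V (q := 0) 0 w₀))

/-- The component `C₄₁` of `ω`, a pairing of `W_0` with `W_2`. -/
def C41 (X : ConstSymp2Groupoid.{u}) (w₀ : cplx0 X.V) (w₂ : cplx2 X.V) : ℝ :=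
  X.ω (assemble X.V 0 0 0 w₀) (assemble X.V w₂ 0 0 0)

/-- The component `C₃₂` of `ω`, a bilinear form on `W_1`. -/
def C32 (X : ConstSymp2Groupoid.{u}) (w w' : cplx1 X.V) : ℝ :=
  X.ω (assemble X.V 0 0 w 0) (assemble X.V 0 w' 0 0)

/-- The map induced on `W_1` by an isomorphism. -/
def SympIso.app1 {X Y : ConstSymp2Groupoid.{u}} (f : SympIso X Y) : cplx1 X.V →ₗ[ℝ] cplx1 Y.V :=
  (f.app 1 ∘ₗ (cplx1 X.V).subtype).codRestrict (cplx1 Y.V) (by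
    intro w
    have h := SimplicialObject.δ_naturality f.iso.hom (n := 0) 0
    have h' : f.app 0 (face X.V (q := 0) 0 w.1) = face Y.V (q := 0) 0 (f.app 1 w.1) :=
      congrArg (fun g => g.hom w.1) h
    have h0 : face X.V (q := 0) 0 w.1 = 0 := w.2
    change face Y.V (q := 0) 0 (f.app 1 w.1) = 0
    rw [← h', h0, map_zero])

/-! ### The linear algebra data -/

/-- The map `∂^* : W_0^* → W_1^* ≅ W_1`, where the identification is made by the form `b`. -/
noncomputable def adjointMap {W₁ W₀ : Type u} [AddCommGroup W₁] [Module ℝ W₁]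
    [FiniteDimensional ℝ W₁] [AddCommGroup W₀] [Module ℝ W₀] (b : LinearMap.BilinForm ℝ W₁)
    (hb : b.Nondegenerate) (d : W₁ →ₗ[ℝ] W₀) : Module.Dual ℝ W₀ →ₗ[ℝ] W₁ :=
  (b.toDual hb).symm.toLinearMap ∘ₗ d.dualMap

/-- Tuples `(W_1, W_0, ⟨·,·⟩, ∂, r)`. Elements of `∧² W_1^*` are alternating bilinear forms. -/
structure LinearData : Type (u + 1) where
  W₁ : Type u
  W₀ : Type u
  [addCommGroup₁ : AddCommGroup W₁]
  [module₁ : Module ℝ W₁]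
  [finiteDimensional₁ : FiniteDimensional ℝ W₁]
  [addCommGroup₀ : AddCommGroup W₀]
  [module₀ : Module ℝ W₀]
  [finiteDimensional₀ : FiniteDimensional ℝ W₀]
  form : LinearMap.BilinForm ℝ W₁
  form_symm : form.IsSymm
  form_nondegenerate : form.Nondegenerate
  bdry : W₁ →ₗ[ℝ] W₀
  isotropic : ∀ x ∈ LinearMap.range (adjointMap form form_nondegenerate bdry),
    ∀ y ∈ LinearMap.range (adjointMap form form_nondegenerate bdry), form x y = 0
  r : LinearMap.BilinForm ℝ W₁
  r_isAlt : r.IsAlt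

attribute [instance] LinearData.addCommGroup₁ LinearData.module₁ LinearData.finiteDimensional₁
  LinearData.addCommGroup₀ LinearData.module₀ LinearData.finiteDimensional₀

/-- The map `∂^* : W_0^* → W_1` of a tuple. -/
noncomputable def LinearData.bdryStar (T : LinearData.{u}) : Module.Dual ℝ T.W₀ →ₗ[ℝ] T.W₁ :=
  adjointMap T.form T.form_nondegenerate T.bdry

/-- An isomorphism of tuples. -/
@[ext]
structure DataIso (S T : LinearData.{u}) where
  e₁ : S.W₁ ≃ₗ[ℝ] T.W₁
  e₀ : S.W₀ ≃ₗ[ℝ] T.W₀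
  map_form : ∀ x y, T.form (e₁ x) (e₁ y) = S.form x y
  map_bdry : ∀ x, T.bdry (e₁ x) = e₀ (S.bdry x)
  map_r : ∀ x y, T.r (e₁ x) (e₁ y) = S.r x y

/-- Tuples up to isomorphism. -/
def dataSetoid : Setoid LinearData.{u} where
  r S T := Nonempty (DataIso S T)
  iseqv :=
    { refl := fun S =>
        ⟨⟨LinearEquiv.refl ℝ _, LinearEquiv.refl ℝ _, fun _ _ => rfl, fun _ => rfl, fun _ _ => rfl⟩⟩
      symm := by
        rintro S T ⟨f⟩
        refine ⟨⟨f.e₁.symm, f.e₀.symm, fun x y => ?_, fun x => ?_, fun x y => ?_⟩⟩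
        · rw [← f.map_form]; simp
        · rw [LinearEquiv.eq_symm_apply, ← f.map_bdry]; simp
        · rw [← f.map_r]; simp
      trans := by
        rintro S T U ⟨f⟩ ⟨g⟩
        refine ⟨⟨f.e₁.trans g.e₁, f.e₀.trans g.e₀, fun x y => ?_, fun x => ?_, fun x y => ?_⟩⟩
        · exact (g.map_form _ _).trans (f.map_form _ _)
        · change U.bdry (g.e₁ (f.e₁ x)) = g.e₀ (f.e₀ (S.bdry x))
          rw [g.map_bdry, f.map_bdry]
        · exact (g.map_r _ _).trans (f.map_r _ _) }

/-! ### The correspondence -/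

/-- The way in which a constant symplectic 2-groupoid `X` corresponds to a tuple `T`: an
isomorphism of the 3-term complex of `X` with `W_0^* → W_1 → W_0` (with differentials `∂^*` and
`∂`) that carries `C₄₁` to the canonical pairing and `C₃₂` to `½ ⟨·,·⟩ + r`. -/
structure Presentation (X : ConstSymp2Groupoid.{u}) (T : LinearData.{u}) where
  e₀ : cplx0 X.V ≃ₗ[ℝ] T.W₀
  e₁ : cplx1 X.V ≃ₗ[ℝ] T.W₁
  e₂ : cplx2 X.V ≃ₗ[ℝ] Module.Dual ℝ T.W₀
  map_bdry1 : ∀ w, e₀ (bdry1 X.V w) = T.bdry (e₁ w)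
  map_bdry2 : ∀ w, e₁ (bdry2 X.V w) = T.bdryStar (e₂ w)
  map_C41 : ∀ w₀ w₂, C41 X w₀ w₂ = e₂ w₂ (e₀ w₀)
  map_C32 : ∀ w w', C32 X w w' = 1 / 2 * T.form (e₁ w) (e₁ w') + T.r (e₁ w) (e₁ w')

/-- An isomorphism `f` of constant symplectic 2-groupoids and an isomorphism `g` of tuples match
each other under the given presentations. -/
def Matches {X Y : ConstSymp2Groupoid.{u}} {S T : LinearData.{u}} (φ : Presentation X S)
    (ψ : Presentation Y T) (f : SympIso X Y) (g : DataIso S T) : Prop :=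
  (∀ x, ψ.e₀ (f.app 0 x) = g.e₀ (φ.e₀ x)) ∧ ∀ w, ψ.e₁ (f.app1 w) = g.e₁ (φ.e₁ w)

end ConstSymplectic

/-! The theorem is the Dold-Kan correspondence for 3-term complexes combined with the analysis of
one form. Splitting off degenerate simplices (`eq_proj1_add`, `eq_proj2_add`) recovers V_1 and V_2
from W_2 → W_1 → W_0, and unique horn filling above degree 2 controls all higher levels. Conversely,
a complex yields the simplicial vector space `cochainVS` of compatible labellings of the vertices,
edges and triangles of simplices; its horns fill because horns in any simplicial vector space do
(`exists_horn_filler`).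

A multiplicative, normalized, alternating form is determined by C₄₁ and C₃₂
(`IsMultiplicative.eq_zero`): evaluating δω = 0 on pairs of degenerate 3-simplices expresses all
other components through these two. Nondegeneracy of A_ω makes C₄₁ an isomorphism of W_2 with W_0^*.
The form B_ω is twice the symmetric part of C₃₂ and gives ⟨·,·⟩; the skew part of C₃₂ is r.
Multiplicativity also makes ∂_2 adjoint to ∂_1 (`symForm_bdry2`), so ∂_2 is ∂^*, and ∂_1 ∂_2 = 0
turns into isotropy of its image. Hence every groupoid has a tuple (`toLinearData`).

In the other direction, `modelForm` is an explicit form on labellings with the prescribed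
components. Given a presentation of X, reading off the labels of simplices is an isomorphism from X
to the model of the tuple (`modelIso`); it preserves the forms because it preserves C₄₁ and C₃₂. So
isomorphisms of tuples lift (`exists_sympIso_matches`). The lift is unique because C₄₁ determines
its action on W_2 from that on W_0 (`Matches.sympIso_unique`). -/

namespace ConstSymplectic

/-! ### Simplicial identities on elements -/

section Identities

variable (V : SimplicialVS.{u})

theorem face_face {q : ℕ} (i j : Fin (q + 2)) (h : i ≤ j) (x : V _⦋q + 2⦌) :
    face V i (face V j.succ x) = face V j (face V i.castSucc x) :=
  congrArg (fun f => f.hom x) (V.δ_comp_δ h)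

theorem face_degen_of_le {q : ℕ} (i : Fin (q + 2)) (j : Fin (q + 1)) (h : i ≤ j.castSucc)
    (x : V _⦋q + 1⦌) : face V i.castSucc (degen V j.succ x) = degen V j (face V i x) :=
  congrArg (fun f => f.hom x) (V.δ_comp_σ_of_le h)

theorem face_degen_of_gt {q : ℕ} (i : Fin (q + 2)) (j : Fin (q + 1)) (h : j.castSucc < i)
    (x : V _⦋q + 1⦌) : face V i.succ (degen V j.castSucc x) = degen V j (face V i x) :=
  congrArg (fun f => f.hom x) (V.δ_comp_σ_of_gt h)

theorem face_degen_self {q : ℕ} (i : Fin (q + 1)) (x : V _⦋q⦌) :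
    face V i.castSucc (degen V i x) = x :=
  congrArg (fun f => f.hom x) (V.δ_comp_σ_self (i := i))

theorem face_degen_succ {q : ℕ} (i : Fin (q + 1)) (x : V _⦋q⦌) :
    face V i.succ (degen V i x) = x :=
  congrArg (fun f => f.hom x) (V.δ_comp_σ_succ (i := i))

/-! Low-dimensional cases.  In the names, the digits are the indices of the maps. -/

theorem face_degen_0_0_0 (x : V _⦋0⦌) : face V (q := 0) 0 (degen V (q := 0) 0 x) = x :=
  face_degen_self V 0 x
theorem face_degen_0_1_0 (x : V _⦋0⦌) : face V (q := 0) 1 (degen V (q := 0) 0 x) = x :=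
  face_degen_succ V 0 x
theorem face_degen_1_0_0 (x : V _⦋1⦌) : face V (q := 1) 0 (degen V (q := 1) 0 x) = x :=
  face_degen_self V 0 x
theorem face_degen_1_1_0 (x : V _⦋1⦌) : face V (q := 1) 1 (degen V (q := 1) 0 x) = x :=
  face_degen_succ V 0 x
theorem face_degen_1_2_0 (x : V _⦋1⦌) : face V (q := 1) 2 (degen V (q := 1) 0 x)
    = degen V (q := 0) 0 (face V (q := 0) 1 x) := face_degen_of_gt V 1 0 (by decide) x
theorem face_degen_1_0_1 (x : V _⦋1⦌) : face V (q := 1) 0 (degen V (q := 1) 1 x)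
    = degen V (q := 0) 0 (face V (q := 0) 0 x) := face_degen_of_le V 0 0 (by decide) x
theorem face_degen_1_1_1 (x : V _⦋1⦌) : face V (q := 1) 1 (degen V (q := 1) 1 x) = x :=
  face_degen_self V 1 x
theorem face_degen_1_2_1 (x : V _⦋1⦌) : face V (q := 1) 2 (degen V (q := 1) 1 x) = x :=
  face_degen_succ V 1 x
theorem face_degen_2_0_0 (x : V _⦋2⦌) : face V (q := 2) 0 (degen V (q := 2) 0 x) = x :=
  face_degen_self V 0 x
theorem face_degen_2_1_0 (x : V _⦋2⦌) : face V (q := 2) 1 (degen V (q := 2) 0 x) = x :=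
  face_degen_succ V 0 x
theorem face_degen_2_2_0 (x : V _⦋2⦌) : face V (q := 2) 2 (degen V (q := 2) 0 x)
    = degen V (q := 1) 0 (face V (q := 1) 1 x) := face_degen_of_gt V 1 0 (by decide) x
theorem face_degen_2_3_0 (x : V _⦋2⦌) : face V (q := 2) 3 (degen V (q := 2) 0 x)
    = degen V (q := 1) 0 (face V (q := 1) 2 x) := face_degen_of_gt V 2 0 (by decide) x
theorem face_degen_2_0_1 (x : V _⦋2⦌) : face V (q := 2) 0 (degen V (q := 2) 1 x)
    = degen V (q := 1) 0 (face V (q := 1) 0 x) := face_degen_of_le V 0 0 (by decide) x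
theorem face_degen_2_1_1 (x : V _⦋2⦌) : face V (q := 2) 1 (degen V (q := 2) 1 x) = x :=
  face_degen_self V 1 x
theorem face_degen_2_2_1 (x : V _⦋2⦌) : face V (q := 2) 2 (degen V (q := 2) 1 x) = x :=
  face_degen_succ V 1 x
theorem face_degen_2_3_1 (x : V _⦋2⦌) : face V (q := 2) 3 (degen V (q := 2) 1 x)
    = degen V (q := 1) 1 (face V (q := 1) 2 x) := face_degen_of_gt V 2 1 (by decide) x
theorem face_degen_2_0_2 (x : V _⦋2⦌) : face V (q := 2) 0 (degen V (q := 2) 2 x)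
    = degen V (q := 1) 1 (face V (q := 1) 0 x) := face_degen_of_le V 0 1 (by decide) x
theorem face_degen_2_1_2 (x : V _⦋2⦌) : face V (q := 2) 1 (degen V (q := 2) 2 x)
    = degen V (q := 1) 1 (face V (q := 1) 1 x) := face_degen_of_le V 1 1 (by decide) x
theorem face_degen_2_2_2 (x : V _⦋2⦌) : face V (q := 2) 2 (degen V (q := 2) 2 x) = x :=
  face_degen_self V 2 x
theorem face_degen_2_3_2 (x : V _⦋2⦌) : face V (q := 2) 3 (degen V (q := 2) 2 x) = x :=
  face_degen_succ V 2 x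

theorem face_face_1_0_1 (x : V _⦋2⦌) : face V (q := 0) 0 (face V (q := 1) 1 x)
    = face V (q := 0) 0 (face V (q := 1) 0 x) := face_face V 0 0 le_rfl x
theorem face_face_1_0_2 (x : V _⦋2⦌) : face V (q := 0) 0 (face V (q := 1) 2 x)
    = face V (q := 0) 1 (face V (q := 1) 0 x) := face_face V 0 1 (by decide) x
theorem face_face_1_1_2 (x : V _⦋2⦌) : face V (q := 0) 1 (face V (q := 1) 2 x)
    = face V (q := 0) 1 (face V (q := 1) 1 x) := face_face V 1 1 le_rfl x

end Identities

/-! ### Splitting off the degenerate part in low degrees -/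

section Splitting

variable (V : SimplicialVS.{u})

/-- The projection of `V_1` onto `W_1` along `σ_0 V_0`. -/
def proj1 : V _⦋1⦌ →ₗ[ℝ] cplx1 V :=
  (LinearMap.id - degen V (q := 0) 0 ∘ₗ face V (q := 0) 0).codRestrict (cplx1 V) (by
    intro x
    change face V (q := 0) 0 (x - degen V (q := 0) 0 (face V (q := 0) 0 x)) = 0
    rw [map_sub, face_degen_0_0_0, sub_self])

theorem proj1_coe (x : V _⦋1⦌) :
    (proj1 V x : V _⦋1⦌) = x - degen V (q := 0) 0 (face V (q := 0) 0 x) := rfl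

/-- The projection of `V_2` onto `W_2` along `σ_0 V_1 + σ_1 V_1`. -/
def proj2 : V _⦋2⦌ →ₗ[ℝ] cplx2 V :=
  (LinearMap.id - degen V (q := 1) 0 ∘ₗ face V (q := 1) 0
    - degen V (q := 1) 1 ∘ₗ (face V (q := 1) 1 - face V (q := 1) 0)).codRestrict (cplx2 V) (by
    intro x
    constructor
    · change face V (q := 1) 0 (x - degen V (q := 1) 0 (face V (q := 1) 0 x)
        - degen V (q := 1) 1 (face V (q := 1) 1 x - face V (q := 1) 0 x)) = 0
      simp only [map_sub, face_degen_1_0_0, face_degen_1_0_1, face_face_1_0_1, sub_self]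
    · change face V (q := 1) 1 (x - degen V (q := 1) 0 (face V (q := 1) 0 x)
        - degen V (q := 1) 1 (face V (q := 1) 1 x - face V (q := 1) 0 x)) = 0
      simp only [map_sub, face_degen_1_1_0, face_degen_1_1_1, sub_self])

theorem proj2_coe (x : V _⦋2⦌) :
    (proj2 V x : V _⦋2⦌) = x - degen V (q := 1) 0 (face V (q := 1) 0 x)
      - degen V (q := 1) 1 (face V (q := 1) 1 x - face V (q := 1) 0 x) := rfl

theorem eq_proj1_add (x : V _⦋1⦌) :
    x = (proj1 V x : V _⦋1⦌) + degen V (q := 0) 0 (face V (q := 0) 0 x) := by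
  rw [proj1_coe]; abel

theorem eq_proj2_add (x : V _⦋2⦌) :
    x = (proj2 V x : V _⦋2⦌) + degen V (q := 1) 0 (face V (q := 1) 0 x)
      + degen V (q := 1) 1 (face V (q := 1) 1 x - face V (q := 1) 0 x) := by
  rw [proj2_coe]; abel

theorem proj1_degen (x : V _⦋0⦌) : proj1 V (degen V (q := 0) 0 x) = 0 := by
  ext
  rw [proj1_coe, face_degen_0_0_0, sub_self]
  rfl

theorem proj2_degen_zero (x : V _⦋1⦌) : proj2 V (degen V (q := 1) 0 x) = 0 := by
  ext
  rw [proj2_coe, face_degen_1_0_0, face_degen_1_1_0, sub_self, sub_self, map_zero, sub_zero]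
  rfl

theorem proj2_degen_one (x : V _⦋1⦌) : proj2 V (degen V (q := 1) 1 x) = 0 := by
  ext
  rw [proj2_coe, face_degen_1_0_1, face_degen_1_1_1, map_sub, degen_degen]
  simp

theorem proj1_of_mem (w : cplx1 V) : proj1 V w = w := by
  ext
  rw [proj1_coe, show face V (q := 0) 0 (w : V _⦋1⦌) = 0 from w.2, map_zero, sub_zero]

theorem proj2_of_mem (w : cplx2 V) : proj2 V w = w := by
  ext
  rw [proj2_coe, show face V (q := 1) 0 (w : V _⦋2⦌) = 0 from w.2.1,
    show face V (q := 1) 1 (w : V _⦋2⦌) = 0 from w.2.2]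
  simp

/-- This identity, `bdry2_proj2` and `proj2_cocycle` become the three label relations of `cochains`
once the projections serve as labels of edges and triangles. -/
theorem bdry1_proj1 (x : V _⦋1⦌) :
    bdry1 V (proj1 V x) = face V (q := 0) 0 x - face V (q := 0) 1 x := by
  change -(face V (q := 0) 1 (proj1 V x : V _⦋1⦌)) = _
  rw [proj1_coe, map_sub, face_degen_0_1_0, neg_sub]

theorem bdry2_proj2 (x : V _⦋2⦌) : bdry2 V (proj2 V x)
    = proj1 V (face V (q := 1) 2 x) + proj1 V (face V (q := 1) 0 x)
      - proj1 V (face V (q := 1) 1 x) := by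
  ext
  change face V (q := 1) 2 (proj2 V x : V _⦋2⦌)
    = (proj1 V (face V (q := 1) 2 x) : V _⦋1⦌) + proj1 V (face V (q := 1) 0 x)
      - proj1 V (face V (q := 1) 1 x)
  simp only [proj2_coe, proj1_coe, map_sub, face_degen_1_2_0, face_degen_1_2_1, face_face_1_0_2,
    face_face_1_0_1]
  abel

theorem proj2_mem_degenerate (x : V _⦋2⦌) : x - (proj2 V x : V _⦋2⦌) ∈ degenerate V 1 := by
  have h : x - (proj2 V x : V _⦋2⦌) = degen V (q := 1) 0 (face V (q := 1) 0 x)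
      + degen V (q := 1) 1 (face V (q := 1) 1 x - face V (q := 1) 0 x) := by
    rw [proj2_coe]; abel
  rw [h]
  exact add_mem (Submodule.mem_iSup_of_mem 0 ⟨_, rfl⟩) (Submodule.mem_iSup_of_mem 1 ⟨_, rfl⟩)

theorem proj1_mem_degenerate (x : V _⦋1⦌) : x - (proj1 V x : V _⦋1⦌) ∈ degenerate V 0 := by
  rw [proj1_coe, sub_sub_cancel]
  exact Submodule.mem_iSup_of_mem 0 ⟨_, rfl⟩

end Splitting

/-! ### Horns -/

section Horns

variable {V : SimplicialVS.{u}}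

theorem isHorn_faces (V : SimplicialVS.{u}) (q : ℕ) (k : Fin (q + 2)) (y : V _⦋q + 1⦌) :
    IsHorn V q k (fun i => face V i.1 y) := by
  cases q with
  | zero => trivial
  | succ m => exact fun i j _ _ h => face_face V i j h y

theorem IsLinearGroupoid.eq_zero_of_faces {V : SimplicialVS.{u}} {n : ℕ}
    (hV : IsLinearGroupoid n V) {q : ℕ} (hq : n < q + 1) (k : Fin (q + 2)) {y : V _⦋q + 1⦌}
    (hy : ∀ i, i ≠ k → face V i y = 0) : y = 0 := by
  have h := isHorn_faces V q k (0 : V _⦋q + 1⦌)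
  obtain ⟨z, -, hz⟩ := hV.horn_bijective q hq k _ h
  rw [hz y fun i => by simpa using hy i.1 i.2, hz 0 fun i => rfl]

theorem IsHorn.sub {m : ℕ} {k : Fin (m + 3)} {x : {i : Fin (m + 3) // i ≠ k} → V _⦋m + 1⦌}
    (hx : IsHorn V (m + 1) k x) (y : V _⦋m + 2⦌) :
    IsHorn V (m + 1) k (fun i => x i - face V i.1 y) := by
  intro i j hi hj h
  have h1 := hx i j hi hj h
  have h2 := face_face V i j h y
  simp only [map_sub]
  rw [h1, h2]

/-- By linearity, a filler of the corrected horn plus the correction fills the original horn. In the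
two inductions below the correction is a degeneracy of one entry; it kills that entry and keeps the
required zeros. -/
theorem exists_horn_filler_of_correction {m : ℕ} {k : Fin (m + 3)}
    {P Q : ({i : Fin (m + 3) // i ≠ k} → V _⦋m + 1⦌) → Prop}
    (hQ : ∀ x, IsHorn V (m + 1) k x → Q x → ∃ y : V _⦋m + 2⦌, ∀ i, face V i.1 y = x i)
    (h : ∀ x, IsHorn V (m + 1) k x → P x → ∃ y : V _⦋m + 2⦌, Q fun i => x i - face V i.1 y)
    (x : {i : Fin (m + 3) // i ≠ k} → V _⦋m + 1⦌) (hx : IsHorn V (m + 1) k x) (hP : P x) :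
    ∃ y : V _⦋m + 2⦌, ∀ i, face V i.1 y = x i := by
  obtain ⟨y, hy⟩ := h x hx hP
  obtain ⟨z, hz⟩ := hQ _ (hx.sub y) hy
  exact ⟨z + y, fun i => by rw [map_add, hz i]; abel⟩

/-- Horns whose faces vanish below `k` and from `d` on can be filled. -/
theorem exists_horn_filler_upper {m : ℕ} (k : Fin (m + 3)) (d : ℕ) :
    ∀ x : {i : Fin (m + 3) // i ≠ k} → V _⦋m + 1⦌, IsHorn V (m + 1) k x →
      (∀ i, (i.1 < k ∨ d ≤ (i.1 : ℕ)) → x i = 0) → ∃ y : V _⦋m + 2⦌, ∀ i, face V i.1 y = x i := by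
  induction d with
  | zero => exact fun x _ h => ⟨0, fun i => by rw [map_zero, h i (Or.inr (Nat.zero_le _))]⟩
  | succ d ih =>
    refine exists_horn_filler_of_correction ih fun x hx h => ?_
    by_cases hd : d < m + 3 ∧ (k : ℕ) < d
    · obtain ⟨hd, hkd⟩ := hd
      -- The entry `x_d` is removed by `σ_{d-1} x_d`, since `f_d σ_{d-1} = id`. Every other face
      -- that has to stay zero is a degeneracy of a face of `x_d`, which by horn compatibility
      -- equals a face of a vanishing entry.
      obtain ⟨e, rfl⟩ : ∃ e, d = e + 1 := ⟨d - 1, by omega⟩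
      have hj : (⟨e, by omega⟩ : Fin (m + 2)).succ ≠ k := by
        intro h; rw [← h] at hkd; simp at hkd
      set j : Fin (m + 2) := ⟨e, by omega⟩ with hjdef
      refine ⟨degen V j (x ⟨j.succ, hj⟩), ?_⟩
      rintro ⟨i, hi⟩ hi'
      dsimp only at hi' ⊢
      by_cases hij : i = j.succ
      · subst hij
        rw [face_degen_succ, sub_self]
      · have hval : (i : ℕ) ≠ e + 1 := fun h => hij (Fin.ext h)
        rw [h ⟨i, hi⟩ (by rcases hi' with h | h; exacts [Or.inl h, Or.inr (by dsimp only; omega)]),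
          zero_sub, neg_eq_zero]
        rcases hi' with hik | hik
        · have hik' : (i : ℕ) < k := hik
          obtain ⟨a, rfl⟩ : ∃ a : Fin (m + 2), i = a.castSucc := ⟨⟨i, by omega⟩, rfl⟩
          obtain ⟨b, hb⟩ : ∃ b : Fin (m + 1), j = b.succ :=
            ⟨⟨e - 1, by omega⟩, Fin.ext (by simp [hjdef]; simp at hik'; omega)⟩
          have hbv : e = b + 1 := by simpa [hjdef] using congrArg Fin.val hb
          have ha : (a : ℕ) < k := hik'
          have := hx a j hi hj (by rw [Fin.le_def]; simp [hjdef]; omega)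
          rw [h ⟨a.castSucc, hi⟩ (Or.inl hik), map_zero] at this
          generalize x ⟨j.succ, hj⟩ = t at this
          rw [hb, face_degen_of_le V a b (by rw [Fin.le_def]; simp; omega), this, map_zero]
        · obtain ⟨a, rfl⟩ : ∃ a : Fin (m + 2), i = a.succ :=
            ⟨⟨i - 1, by omega⟩, Fin.ext (by simp; omega)⟩
          have hae : e < (a : ℕ) := by simp at hik hval; omega
          obtain ⟨b, hb⟩ : ∃ b : Fin (m + 1), j = b.castSucc :=
            ⟨⟨e, by omega⟩, Fin.ext (by simp [hjdef])⟩
          have hbv : e = b := by simpa [hjdef] using congrArg Fin.val hb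
          obtain ⟨j', hj'⟩ : ∃ j' : Fin (m + 2), j.succ = j'.castSucc :=
            ⟨⟨e + 1, by omega⟩, Fin.ext (by simp [hjdef])⟩
          have hjv : e + 1 = j' := by simpa [hjdef] using congrArg Fin.val hj'
          have := hx j' a (hj' ▸ hj) hi (by rw [Fin.le_def]; omega)
          rw [h ⟨a.succ, hi⟩ (Or.inr (by simp; omega)), map_zero] at this
          have h2 : face V a (x ⟨j.succ, hj⟩) = 0 := by simpa only [hj'] using this.symm
          generalize x ⟨j.succ, hj⟩ = t at h2
          rw [hb, face_degen_of_gt V a b (by rw [Fin.lt_def]; simp; omega), h2, map_zero]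
    -- Here no entry has index `d > k`, so the vanishing condition for `d` already holds.
    · refine ⟨0, fun i hi => ?_⟩
      dsimp only
      rw [map_zero, sub_zero]
      refine h i (by_contra fun hc => hd ?_)
      have := i.2
      rw [← Fin.val_ne_iff] at this
      simp only [Fin.lt_def] at hi hc
      omega

/-- Horns whose faces vanish below `min k (k - d)` can be filled. -/
theorem exists_horn_filler_lower {m : ℕ} (k : Fin (m + 3)) (d : ℕ) :
    ∀ x : {i : Fin (m + 3) // i ≠ k} → V _⦋m + 1⦌, IsHorn V (m + 1) k x →
      (∀ i, i.1 < k → (i.1 : ℕ) + d < k → x i = 0) →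
        ∃ y : V _⦋m + 2⦌, ∀ i, face V i.1 y = x i := by
  induction d with
  | zero =>
    exact fun x hx h => exists_horn_filler_upper k (m + 3) x hx fun i hi =>
      h i (by have := i.1.2; omega) (by have := i.1.2; omega)
  | succ d ih =>
    refine exists_horn_filler_of_correction ih fun x hx h => ?_
    by_cases hd : d < k
    · have hk := k.2
      -- Below `k` the entries are removed in increasing order: `j = k - d - 1` is the first that
      -- may be nonzero, and `f_j σ_j = id`.
      have hj : (⟨k - (d + 1), by omega⟩ : Fin (m + 2)).castSucc ≠ k := by
        rw [← Fin.val_ne_iff]; simp; omega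
      set j : Fin (m + 2) := ⟨k - (d + 1), by omega⟩ with hjdef
      have hjv : (j : ℕ) = k - (d + 1) := rfl
      refine ⟨degen V j (x ⟨j.castSucc, hj⟩), ?_⟩
      rintro ⟨i, hi⟩ hik hid
      dsimp only at hik hid ⊢
      by_cases hij : i = j.castSucc
      · subst hij
        rw [face_degen_self, sub_self]
      · have hval : (i : ℕ) ≠ j := fun h => hij (Fin.ext h)
        have hi0 := h ⟨i, hi⟩ hik (by dsimp only; omega)
        rw [hi0, zero_sub, neg_eq_zero]
        obtain ⟨a, rfl⟩ : ∃ a : Fin (m + 2), i = a.castSucc := ⟨⟨i, by omega⟩, rfl⟩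
        have hav : (a : ℕ) < j := by simp at hval hid; omega
        obtain ⟨b, hb⟩ : ∃ b : Fin (m + 1), j = b.succ :=
          ⟨⟨j - 1, by omega⟩, Fin.ext (by simp; omega)⟩
        have hbv : (j : ℕ) = b + 1 := by simpa using congrArg Fin.val hb
        obtain ⟨j', hj'⟩ : ∃ j' : Fin (m + 2), j.castSucc = j'.succ :=
          ⟨⟨j - 1, by omega⟩, Fin.ext (by simp; omega)⟩
        have hjv' : (j : ℕ) = j' + 1 := by simpa using congrArg Fin.val hj'
        have := hx a j' hi (hj' ▸ hj) (by rw [Fin.le_def]; omega)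
        rw [hi0, map_zero] at this
        have h2 : face V a (x ⟨j.castSucc, hj⟩) = 0 := by simpa only [hj'] using this
        generalize x ⟨j.castSucc, hj⟩ = t at h2
        rw [hb, face_degen_of_le V a b (by rw [Fin.le_def]; simp; omega), h2, map_zero]
    · refine ⟨0, fun i hi hid => ?_⟩
      omega

/-- Horns in a simplicial vector space can be filled. -/
theorem exists_horn_filler (V : SimplicialVS.{u}) (q : ℕ) (k : Fin (q + 2))
    (x : {i : Fin (q + 2) // i ≠ k} → V _⦋q⦌) (hx : IsHorn V q k x) :
    ∃ y : V _⦋q + 1⦌, ∀ i, face V i.1 y = x i := by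
  cases q with
  | zero =>
    -- A 1-horn is a single vertex, indexed by `k + 1` modulo 2; its degenerate edge is a filler.
    have hk : k + 1 ≠ k := by fin_cases k <;> decide
    refine ⟨degen V 0 (x ⟨k + 1, hk⟩), ?_⟩
    rintro ⟨i, hi⟩
    obtain rfl : i = k + 1 := by
      fin_cases k <;> fin_cases i <;> first | rfl | exact absurd rfl hi
    generalize x ⟨k + 1, hi⟩ = t
    fin_cases k
    · exact face_degen_succ V 0 t
    · exact face_degen_self V 0 t
  | succ m => exact exists_horn_filler_lower k (m + 3) x hx fun i _ h => by omega

/-- Fillers exist in any case, so only the kernels of the horn maps above degree `n` matter. -/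
theorem isLinearGroupoid_of_faces {n : ℕ} (hfin : ∀ q : ℕ, FiniteDimensional ℝ (V _⦋q⦌))
    (hV : ∀ q : ℕ, n < q + 1 → ∀ (k : Fin (q + 2)) (y : V _⦋q + 1⦌),
      (∀ i, i ≠ k → face V i y = 0) → y = 0) : IsLinearGroupoid n V where
  finiteDimensional := hfin
  horn_surjective := exists_horn_filler V
  horn_bijective q hq k x hx := by
    obtain ⟨y, hy⟩ := exists_horn_filler V q k x hx
    refine ⟨y, hy, fun z hz => ?_⟩
    rw [← sub_eq_zero]
    refine hV q hq k _ fun i hi => ?_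
    rw [map_sub, hz ⟨i, hi⟩, hy ⟨i, hi⟩, sub_self]

end Horns

/-! ### The third level of a linear 2-groupoid -/

/-- The normalized complex vanishes in degree 3: subtracting suitable degeneracies kills `f_0`,
`f_1`, `f_2` in turn, and the `(3, 3)`-horn map is injective. -/
theorem IsLinearGroupoid.eq_sum_degen {V : SimplicialVS.{u}} (hV : IsLinearGroupoid 2 V)
    (x : V _⦋3⦌) : ∃ y₀ y₁ y₂ : V _⦋2⦌,
      x = degen V (q := 2) 0 y₀ + degen V (q := 2) 1 y₁ + degen V (q := 2) 2 y₂ := by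
  set y₀ := face V (q := 2) 0 x
  set y₁ := face V (q := 2) 1 x - face V (q := 2) 0 x
  set y₂ := face V (q := 2) 2 (x - degen V (q := 2) 0 y₀ - degen V (q := 2) 1 y₁)
  have e1 : face V (q := 1) 0 (face V (q := 2) 1 x) = face V (q := 1) 0 (face V (q := 2) 0 x) :=
    face_face V (q := 1) 0 0 le_rfl x
  have e2 : face V (q := 1) 0 (face V (q := 2) 2 x) = face V (q := 1) 1 (face V (q := 2) 0 x) :=
    face_face V (q := 1) 0 1 (by decide) x
  have e3 : face V (q := 1) 1 (face V (q := 2) 2 x) = face V (q := 1) 1 (face V (q := 2) 1 x) :=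
    face_face V (q := 1) 1 1 le_rfl x
  refine ⟨y₀, y₁, y₂, ?_⟩
  have key : x - degen V (q := 2) 0 y₀ - degen V (q := 2) 1 y₁ - degen V (q := 2) 2 y₂ = 0 := by
    refine hV.eq_zero_of_faces (q := 2) (by norm_num) 3 fun i hi => ?_
    fin_cases i
    · change face V (q := 2) 0 _ = 0
      simp only [y₂, y₁, y₀, map_sub, face_degen_2_0_0, face_degen_2_0_1, face_degen_2_0_2,
        face_degen_2_2_0, face_degen_2_2_1, face_degen_1_0_0, e1, e2]
      simp
    · change face V (q := 2) 1 _ = 0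
      simp only [y₂, y₁, y₀, map_sub, face_degen_2_1_0, face_degen_2_1_1, face_degen_2_1_2,
        face_degen_2_2_0, face_degen_2_2_1, face_degen_1_1_0, e3]
      simp
    · change face V (q := 2) 2 _ = 0
      simp only [y₂, map_sub, face_degen_2_2_2]
      simp
    · exact absurd rfl hi
  rw [← sub_eq_zero, ← key]
  abel

/-- For a degenerate 3-simplex two adjacent faces coincide and cancel, while the other two are
degenerate and die under `proj2`. -/
theorem IsLinearGroupoid.proj2_cocycle {V : SimplicialVS.{u}} (hV : IsLinearGroupoid 2 V)
    (x : V _⦋3⦌) : proj2 V (face V (q := 2) 0 x) - proj2 V (face V (q := 2) 1 x)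
      + proj2 V (face V (q := 2) 2 x) - proj2 V (face V (q := 2) 3 x) = 0 := by
  obtain ⟨y₀, y₁, y₂, rfl⟩ := hV.eq_sum_degen x
  simp only [map_add, face_degen_2_0_0, face_degen_2_1_0, face_degen_2_2_0, face_degen_2_3_0,
    face_degen_2_0_1, face_degen_2_1_1, face_degen_2_2_1, face_degen_2_3_1,
    face_degen_2_0_2, face_degen_2_1_2, face_degen_2_2_2, face_degen_2_3_2,
    proj2_degen_zero, proj2_degen_one]
  abel

/-! ### Maps of simplicial vector spaces -/

section Maps

variable {V V' : SimplicialVS.{u}}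

/-- The component in degree `q` of a map of simplicial vector spaces. -/
abbrev appLin (f : V ⟶ V') (q : ℕ) : V _⦋q⦌ →ₗ[ℝ] V' _⦋q⦌ := (f.app (op ⦋q⦌)).hom

theorem face_appLin (f : V ⟶ V') {q : ℕ} (i : Fin (q + 2)) (x : V _⦋q + 1⦌) :
    face V' i (appLin f (q + 1) x) = appLin f q (face V i x) :=
  (congrArg (fun g => g.hom x) (SimplicialObject.δ_naturality f i)).symm

theorem degen_appLin (f : V ⟶ V') {q : ℕ} (i : Fin (q + 1)) (x : V _⦋q⦌) :
    degen V' i (appLin f q x) = appLin f (q + 1) (degen V i x) :=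
  (congrArg (fun g => g.hom x) (SimplicialObject.σ_naturality f i)).symm

/-- The map induced on `W_1`. -/
def cplx1Map (f : V ⟶ V') : cplx1 V →ₗ[ℝ] cplx1 V' :=
  (appLin f 1 ∘ₗ (cplx1 V).subtype).codRestrict (cplx1 V') (by
    intro w
    change face V' (q := 0) 0 (appLin f 1 w.1) = 0
    rw [face_appLin, show face V (q := 0) 0 w.1 = 0 from w.2, map_zero])

/-- The map induced on `W_2`. -/
def cplx2Map (f : V ⟶ V') : cplx2 V →ₗ[ℝ] cplx2 V' :=
  (appLin f 2 ∘ₗ (cplx2 V).subtype).codRestrict (cplx2 V') (by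
    intro w
    constructor
    · change face V' (q := 1) 0 (appLin f 2 w.1) = 0
      rw [face_appLin, show face V (q := 1) 0 w.1 = 0 from w.2.1, map_zero]
    · change face V' (q := 1) 1 (appLin f 2 w.1) = 0
      rw [face_appLin, show face V (q := 1) 1 w.1 = 0 from w.2.2, map_zero])

theorem cplx1Map_coe (f : V ⟶ V') (w : cplx1 V) : (cplx1Map f w : V' _⦋1⦌) = appLin f 1 w := rfl

theorem cplx2Map_coe (f : V ⟶ V') (w : cplx2 V) : (cplx2Map f w : V' _⦋2⦌) = appLin f 2 w := rfl

theorem proj1_appLin (f : V ⟶ V') (x : V _⦋1⦌) :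
    proj1 V' (appLin f 1 x) = cplx1Map f (proj1 V x) := by
  ext
  rw [cplx1Map_coe, proj1_coe, proj1_coe, map_sub, face_appLin, degen_appLin]

theorem proj2_appLin (f : V ⟶ V') (x : V _⦋2⦌) :
    proj2 V' (appLin f 2 x) = cplx2Map f (proj2 V x) := by
  ext
  simp only [cplx2Map_coe, proj2_coe, map_sub, face_appLin, degen_appLin]

theorem bdry1_cplx1Map (f : V ⟶ V') (w : cplx1 V) :
    bdry1 V' (cplx1Map f w) = appLin f 0 (bdry1 V w) := by
  change -(face V' (q := 0) 1 (appLin f 1 w.1)) = appLin f 0 (-(face V (q := 0) 1 w.1))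
  rw [map_neg, face_appLin]

/-- A linear map between the levels of two linear `n`-groupoids is bijective above `n` if it is so
up to `n`. -/
theorem bijective_appLin {n : ℕ} (hV : IsLinearGroupoid n V) (hV' : IsLinearGroupoid n V')
    (hn : 1 ≤ n) (f : V ⟶ V') (h : ∀ q ≤ n, Function.Bijective (appLin f q)) (q : ℕ) :
    Function.Bijective (appLin f q) := by
  induction q using Nat.strong_induction_on with
  | _ q ih =>
    by_cases hq : q ≤ n
    · exact h _ hq
    -- Since `q > n ≥ 1`, both `m + 1` and `m` are natural numbers below `q`; the horn equations
    -- live in degree `m`.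
    obtain ⟨m, rfl⟩ : ∃ m, q = m + 1 + 1 := ⟨q - 2, by omega⟩
    have ih₁ := ih (m + 1) (by omega)
    have inj : Function.Injective (appLin f (m + 1 + 1)) := by
      rw [injective_iff_map_eq_zero]
      intro y hy
      refine hV.eq_zero_of_faces (by omega) 0 fun i _ => ih₁.1 ?_
      rw [← face_appLin, hy, map_zero, map_zero]
    refine ⟨inj, fun z => ?_⟩
    -- The preimages of the faces of `z` form a horn by injectivity in degree `m`. The image of its
    -- filler shares a horn with `z`, hence equals `z`.
    choose g hg using ih₁.2
    obtain ⟨y, hy⟩ := hV.horn_surjective (m + 1) 0 (fun i => g (face V' i.1 z)) (by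
      intro i j _ _ hij
      apply (ih m (by omega)).1
      rw [← face_appLin, ← face_appLin, hg, hg]
      exact face_face V' i j hij z)
    refine ⟨y, ?_⟩
    rw [← sub_eq_zero]
    refine hV'.eq_zero_of_faces (by omega) 0 fun i hi => ?_
    rw [map_sub, face_appLin, hy ⟨i, hi⟩, hg, sub_self]

/-- The splittings into `W_1`, `W_2` and degenerate parts are natural, which settles degrees 1 and
2; horn filling does the rest. -/
theorem bijective_appLin_of_cplx (hV : IsLinearGroupoid 2 V) (hV' : IsLinearGroupoid 2 V')
    (f : V ⟶ V') (h₀ : Function.Bijective (appLin f 0)) (h₁ : Function.Bijective (cplx1Map f))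
    (h₂ : Function.Bijective (cplx2Map f)) (q : ℕ) : Function.Bijective (appLin f q) := by
  have b₁ : Function.Bijective (appLin f 1) := by
    constructor
    · rw [injective_iff_map_eq_zero]
      intro x hx
      have e₀ : face V (q := 0) 0 x = 0 := h₀.1 (by rw [← face_appLin, hx, map_zero, map_zero])
      have e₁ : proj1 V x = 0 := h₁.1 (by rw [← proj1_appLin, hx, map_zero, map_zero])
      rw [eq_proj1_add V x, e₀, e₁, map_zero, add_zero]
      rfl
    · intro z
      obtain ⟨v, hv⟩ := h₀.2 (face V' (q := 0) 0 z)
      obtain ⟨w, hw⟩ := h₁.2 (proj1 V' z)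
      refine ⟨(w : V _⦋1⦌) + degen V (q := 0) 0 v, ?_⟩
      rw [map_add, ← cplx1Map_coe, hw, ← degen_appLin, hv, ← eq_proj1_add]
  have b₂ : Function.Bijective (appLin f 2) := by
    constructor
    · rw [injective_iff_map_eq_zero]
      intro x hx
      have e₀ : face V (q := 1) 0 x = 0 := b₁.1 (by rw [← face_appLin, hx, map_zero, map_zero])
      have e₁ : face V (q := 1) 1 x = 0 := b₁.1 (by rw [← face_appLin, hx, map_zero, map_zero])
      have e₂ : proj2 V x = 0 := h₂.1 (by rw [← proj2_appLin, hx, map_zero, map_zero])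
      rw [eq_proj2_add V x, e₀, e₁, e₂, sub_zero, map_zero, map_zero, add_zero, add_zero]
      rfl
    · intro z
      obtain ⟨v, hv⟩ := b₁.2 (face V' (q := 1) 0 z)
      obtain ⟨v', hv'⟩ := b₁.2 (face V' (q := 1) 1 z - face V' (q := 1) 0 z)
      obtain ⟨w, hw⟩ := h₂.2 (proj2 V' z)
      refine ⟨(w : V _⦋2⦌) + degen V (q := 1) 0 v + degen V (q := 1) 1 v', ?_⟩
      rw [map_add, map_add, ← cplx2Map_coe, hw, ← degen_appLin, ← degen_appLin, hv, hv',
        ← eq_proj2_add]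
  refine bijective_appLin hV hV' (by norm_num) f (fun q hq => ?_) q
  interval_cases q
  exacts [h₀, b₁, b₂]

/-- A levelwise bijective map of simplicial vector spaces, as an isomorphism. -/
noncomputable def isoOfBijective (f : V ⟶ V') (h : ∀ q, Function.Bijective (appLin f q)) :
    V ≅ V' :=
  haveI : ∀ q, IsIso (f.app q) := fun q => by
    rw [ConcreteCategory.isIso_iff_bijective]
    exact h q.unop.len
  haveI : IsIso f := NatIso.isIso_of_isIso_app f
  asIso f

/-- Maps into a linear `n`-groupoid that agree up to degree `n` are equal. -/
theorem hom_ext_of_le {n : ℕ} (hV' : IsLinearGroupoid n V') {f g : V ⟶ V'}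
    (h : ∀ q ≤ n, appLin f q = appLin g q) : f = g := by
  have key : ∀ q, appLin f q = appLin g q := by
    intro q
    induction q with
    | zero => exact h 0 (Nat.zero_le n)
    | succ q ih =>
      by_cases hq : q + 1 ≤ n
      · exact h _ hq
      ext x
      rw [← sub_eq_zero]
      refine hV'.eq_zero_of_faces (by omega) 0 fun i _ => ?_
      rw [map_sub, face_appLin, face_appLin, ih, sub_self]
  refine SimplicialObject.hom_ext f g fun q => ?_
  ext x
  exact congrArg (fun l => l x) (key q.unop.len)

end Maps

/-! ### Multiplicative normalized forms -/

section Forms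

variable {V : SimplicialVS.{u}} {ω : LinearMap.BilinForm ℝ (V _⦋2⦌)}

theorem isMultiplicative_iff : IsMultiplicative V (q := 2) ω ↔ ∀ x y : V _⦋3⦌,
    ω (face V (q := 2) 0 x) (face V (q := 2) 0 y) - ω (face V (q := 2) 1 x) (face V (q := 2) 1 y)
      + ω (face V (q := 2) 2 x) (face V (q := 2) 2 y)
      - ω (face V (q := 2) 3 x) (face V (q := 2) 3 y) = 0 := by
  have e : ∀ x y : V _⦋3⦌, coboundary V ω x y
      = ω (face V (q := 2) 0 x) (face V (q := 2) 0 y) - ω (face V (q := 2) 1 x) (face V (q := 2) 1 y)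
      + ω (face V (q := 2) 2 x) (face V (q := 2) 2 y)
      - ω (face V (q := 2) 3 x) (face V (q := 2) 3 y) := fun x y => by
    simp [coboundary, Fin.sum_univ_succ]
    ring_nf
  simp only [← e]
  exact ⟨fun h x y => congrArg (fun b : LinearMap.BilinForm ℝ (V _⦋3⦌) => b x y) h,
    fun h => LinearMap.ext fun x => LinearMap.ext fun y => h x y⟩

theorem IsMultiplicative.apply (h : IsMultiplicative V (q := 2) ω) (x y : V _⦋3⦌) :
    ω (face V (q := 2) 0 x) (face V (q := 2) 0 y) - ω (face V (q := 2) 1 x) (face V (q := 2) 1 y)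
      + ω (face V (q := 2) 2 x) (face V (q := 2) 2 y)
      - ω (face V (q := 2) 3 x) (face V (q := 2) 3 y) = 0 := isMultiplicative_iff.1 h x y

/-! ### Components of a multiplicative form. -/

theorem face_zero_of_mem (u : cplx1 V) : face V (q := 0) 0 u.1 = 0 := u.2
theorem face_one_of_mem (u : cplx1 V) : face V (q := 0) 1 u.1 = -bdry1 V u := (neg_neg _).symm
theorem face_zero_of_mem₂ (w : cplx2 V) : face V (q := 1) 0 w.1 = 0 := w.2.1
theorem face_one_of_mem₂ (w : cplx2 V) : face V (q := 1) 1 w.1 = 0 := w.2.2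
theorem face_two_of_mem₂ (w : cplx2 V) : face V (q := 1) 2 w.1 = (bdry2 V w).1 := rfl

/-- Here and in the next three lemmas the two 3-simplices are chosen so that few terms of δω
survive. The faces of `σ_0 w` are `(w, w, 0, σ_0 ∂_2 w)`, those of `σ_1 w'` are `(0, w', w', σ_1 ∂_2
w')`. -/
theorem IsMultiplicative.apply_two_two (hm : IsMultiplicative V (q := 2) ω) (w w' : cplx2 V) :
    ω w.1 w'.1 = -ω (degen V (q := 1) 0 (bdry2 V w).1) (degen V (q := 1) 1 (bdry2 V w').1) := by
  have h := hm.apply (degen V (q := 2) 0 w.1) (degen V (q := 2) 1 w'.1)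
  simp only [face_degen_2_0_0, face_degen_2_1_0, face_degen_2_2_0, face_degen_2_3_0,
    face_degen_2_0_1, face_degen_2_1_1, face_degen_2_2_1, face_degen_2_3_1,
    face_zero_of_mem₂, face_one_of_mem₂, face_two_of_mem₂, map_zero, LinearMap.zero_apply] at h
  linarith

theorem IsMultiplicative.apply_two_degen_one (hm : IsMultiplicative V (q := 2) ω) (w : cplx2 V)
    (u : cplx1 V) : ω w.1 (degen V (q := 1) 1 u.1)
      = -ω (degen V (q := 1) 0 (bdry2 V w).1) (degen V (q := 1) 1 u.1) := by
  -- The faces of `σ_2 σ_1 u` are `(0, σ_1 u, σ_1 u, σ_1 u)`.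
  have h := hm.apply (degen V (q := 2) 0 w.1) (degen V (q := 2) 2 (degen V (q := 1) 1 u.1))
  simp only [face_degen_2_0_0, face_degen_2_1_0, face_degen_2_2_0, face_degen_2_3_0,
    face_degen_2_0_2, face_degen_2_1_2, face_degen_2_2_2, face_degen_2_3_2, face_degen_1_0_1,
    face_degen_1_1_1, face_zero_of_mem,
    face_one_of_mem₂, face_two_of_mem₂, map_zero, LinearMap.zero_apply] at h
  linarith

theorem IsMultiplicative.apply_two_degen_zero (hm : IsMultiplicative V (q := 2) ω) (w : cplx2 V)
    (u : cplx1 V) : ω w.1 (degen V (q := 1) 0 u.1)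
      = -ω w.1 (degen V (q := 1) 0 (degen V (q := 0) 0 (bdry1 V u))) := by
  -- Faces: `(0, 0, w, w)` and `(σ_0 u, σ_0 u, σ_0 u, -σ_0 σ_0 ∂_1 u)`.
  have h := hm.apply (degen V (q := 2) 2 w.1) (degen V (q := 2) 1 (degen V (q := 1) 0 u.1))
  simp only [face_degen_2_2_2, face_degen_2_0_2, face_degen_2_1_2, face_degen_2_3_2,
    face_degen_2_0_1, face_degen_2_1_1, face_degen_2_2_1, face_degen_2_3_1, face_degen_1_2_0,
    face_one_of_mem, degen_degen,
    face_zero_of_mem₂, face_one_of_mem₂, map_zero, map_neg, LinearMap.zero_apply] at h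
  linarith

theorem IsMultiplicative.apply_bdry2_degen (hm : IsMultiplicative V (q := 2) ω) (w : cplx2 V)
    (u : cplx1 V) : ω w.1 (degen V (q := 1) 0 u.1) = ω w.1 (degen V (q := 1) 1 u.1)
      + ω (degen V (q := 1) 1 (bdry2 V w).1) (degen V (q := 1) 0 u.1) := by
  -- Faces: `(0, w, w, σ_1 ∂_2 w)` and `(σ_1 u, σ_1 u, σ_0 u, σ_0 u)`.
  have h := hm.apply (degen V (q := 2) 1 w.1) (degen V (q := 2) 2 (degen V (q := 1) 0 u.1))
  simp only [face_degen_2_2_2, face_degen_2_0_2, face_degen_2_1_2, face_degen_2_3_2,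
    face_degen_2_0_1, face_degen_2_1_1, face_degen_2_2_1, face_degen_2_3_1, face_degen_1_1_0,
    face_degen_1_0_0, face_zero_of_mem₂, face_two_of_mem₂, map_zero, LinearMap.zero_apply] at h
  linarith

/-- A multiplicative normalized form is determined by its components `C₄₁` and `C₃₂`. -/
theorem IsMultiplicative.eq_zero (hm : IsMultiplicative V (q := 2) ω)
    (hn : IsNormalized V (q := 1) ω) (ha : ω.IsAlt)
    (hA : ∀ (v : V _⦋0⦌) (w : cplx2 V), ω (degen V (q := 1) 0 (degen V (q := 0) 0 v)) w.1 = 0)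
    (hC : ∀ u u' : cplx1 V, ω (degen V (q := 1) 1 u.1) (degen V (q := 1) 0 u'.1) = 0) :
    ω = 0 := by
  have hC' : ∀ u u' : cplx1 V, ω (degen V (q := 1) 0 u.1) (degen V (q := 1) 1 u'.1) = 0 :=
    fun u u' => by rw [← ha.neg_eq, hC, neg_zero]
  have hA' : ∀ (v : V _⦋0⦌) (w : cplx2 V),
      ω w.1 (degen V (q := 1) 0 (degen V (q := 0) 0 v)) = 0 :=
    fun u u' => by rw [← ha.neg_eq, hA, neg_zero]
  have hww : ∀ w w' : cplx2 V, ω w.1 w'.1 = 0 := fun w w' => by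
    rw [hm.apply_two_two, hC', neg_zero]
  have hw0 : ∀ (w : cplx2 V) (x : V _⦋1⦌), ω w.1 (degen V (q := 1) 0 x) = 0 := fun w x => by
    rw [eq_proj1_add V x, map_add, map_add, hA', hm.apply_two_degen_zero, hA', neg_zero, add_zero]
  have hw1 : ∀ (w : cplx2 V) (x : V _⦋1⦌), ω w.1 (degen V (q := 1) 1 x) = 0 := fun w x => by
    rw [eq_proj1_add V x, map_add, map_add, degen_degen, hA', hm.apply_two_degen_one, hC',
      neg_zero, add_zero]
  -- A vector `σ_0 σ_0 v = σ_1 σ_0 v` lies in both degenerate images, so normalization kills its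
  -- pairing with either; only the `W_1`-`W_1` term, a value of C₃₂ up to sign, remains.
  have h01 : ∀ x y : V _⦋1⦌, ω (degen V (q := 1) 0 x) (degen V (q := 1) 1 y) = 0 := fun x y => by
    rw [eq_proj1_add V x, eq_proj1_add V y, map_add, map_add, map_add, map_add,
      LinearMap.add_apply, LinearMap.add_apply, hC', degen_degen, hn.apply 0, ← degen_degen,
      hn.apply 1, ← degen_degen, hn.apply 1]
    simp
  have flip : ∀ x y, ω x y = 0 → ω y x = 0 := fun x y h => by rw [← ha.neg_eq, h, neg_zero]
  refine LinearMap.ext fun x => LinearMap.ext fun y => ?_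
  rw [eq_proj2_add V x, eq_proj2_add V y]
  simp only [map_add ω, map_add (ω _), LinearMap.add_apply, hww, hw0, hw1, h01, flip _ _ (hw0 _ _),
    flip _ _ (hw1 _ _), flip _ _ (h01 _ _), hn.apply 0, hn.apply 1, LinearMap.zero_apply, add_zero]

end Forms

/-! ### The simplicial vector space of a 3-term complex

An `n`-simplex assigns elements of `W₀`, `W₁`, `W₂` to the vertices, edges and triangles of the
standard `n`-simplex, compatibly with the differentials. -/

section Cochains

variable {W₀ W₁ W₂ : Type u} [AddCommGroup W₀] [Module ℝ W₀] [AddCommGroup W₁] [Module ℝ W₁]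
  [AddCommGroup W₂] [Module ℝ W₂] (d₁ : W₁ →ₗ[ℝ] W₀) (d₂ : W₂ →ₗ[ℝ] W₁)

/-- The labellings of vertices, edges and triangles of the standard `n`-simplex by `W₀`, `W₁`,
`W₂`, compatible with the differentials. -/
def cochains (n : ℕ) : Submodule ℝ ((Fin (n + 1) → W₀) × (Fin (n + 1) → Fin (n + 1) → W₁) ×
    (Fin (n + 1) → Fin (n + 1) → Fin (n + 1) → W₂)) where
  -- The relations range over weakly increasing indices, so that any monotone map preserves them;
  -- for repeated indices they follow from the two vanishing conditions.
  carrier := {x | (∀ i j, ¬ i < j → x.2.1 i j = 0) ∧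
    (∀ i j k, ¬ (i < j ∧ j < k) → x.2.2 i j k = 0) ∧
    (∀ i j, i ≤ j → d₁ (x.2.1 i j) = x.1 j - x.1 i) ∧
    (∀ i j k, i ≤ j → j ≤ k → d₂ (x.2.2 i j k) = x.2.1 i j + x.2.1 j k - x.2.1 i k) ∧
    (∀ i j k l, i ≤ j → j ≤ k → k ≤ l →
      x.2.2 j k l - x.2.2 i k l + x.2.2 i j l - x.2.2 i j k = 0)}
  zero_mem' := by simp
  add_mem' := by
    rintro x y ⟨h1, h2, h3, h4, h5⟩ ⟨h1', h2', h3', h4', h5'⟩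
    refine ⟨fun i j h => ?_, fun i j k h => ?_, fun i j h => ?_, fun i j k h h' => ?_,
      fun i j k l h h' h'' => ?_⟩
    · change x.2.1 i j + y.2.1 i j = 0
      rw [h1 i j h, h1' i j h, add_zero]
    · change x.2.2 i j k + y.2.2 i j k = 0
      rw [h2 i j k h, h2' i j k h, add_zero]
    · change d₁ (x.2.1 i j + y.2.1 i j) = (x.1 j + y.1 j) - (x.1 i + y.1 i)
      rw [map_add, h3 i j h, h3' i j h]
      abel
    · change d₂ (x.2.2 i j k + y.2.2 i j k) = (x.2.1 i j + y.2.1 i j) + (x.2.1 j k + y.2.1 j k)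
        - (x.2.1 i k + y.2.1 i k)
      rw [map_add, h4 i j k h h', h4' i j k h h']
      abel
    · change (x.2.2 j k l + y.2.2 j k l) - (x.2.2 i k l + y.2.2 i k l)
        + (x.2.2 i j l + y.2.2 i j l) - (x.2.2 i j k + y.2.2 i j k) = 0
      have e := congrArg₂ (· + ·) (h5 i j k l h h' h'') (h5' i j k l h h' h'')
      simp only [add_zero] at e
      rw [← e]
      abel
  smul_mem' := by
    rintro c x ⟨h1, h2, h3, h4, h5⟩
    refine ⟨fun i j h => ?_, fun i j k h => ?_, fun i j h => ?_, fun i j k h h' => ?_,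
      fun i j k l h h' h'' => ?_⟩
    · change c • x.2.1 i j = 0
      rw [h1 i j h, smul_zero]
    · change c • x.2.2 i j k = 0
      rw [h2 i j k h, smul_zero]
    · change d₁ (c • x.2.1 i j) = c • x.1 j - c • x.1 i
      rw [map_smul, h3 i j h, smul_sub]
    · change d₂ (c • x.2.2 i j k) = c • x.2.1 i j + c • x.2.1 j k - c • x.2.1 i k
      rw [map_smul, h4 i j k h h', smul_sub, smul_add]
    · change c • x.2.2 j k l - c • x.2.2 i k l + c • x.2.2 i j l - c • x.2.2 i j k = 0
      rw [← smul_sub, ← smul_add, ← smul_sub, h5 i j k l h h' h'', smul_zero]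

/-- Restriction of labellings along a monotone map. -/
def cochainsMap {m n : ℕ} (θ : Fin (m + 1) →o Fin (n + 1)) :
    cochains d₁ d₂ n →ₗ[ℝ] cochains d₁ d₂ m where
  toFun x := ⟨(fun i => x.1.1 (θ i), fun i j => x.1.2.1 (θ i) (θ j),
      fun i j k => x.1.2.2 (θ i) (θ j) (θ k)), by
    obtain ⟨h1, h2, h3, h4, h5⟩ := x.2
    refine ⟨fun i j h => h1 _ _ fun h' => h (θ.monotone.reflect_lt h'),
      fun i j k h => h2 _ _ _ fun h' => h ⟨θ.monotone.reflect_lt h'.1, θ.monotone.reflect_lt h'.2⟩,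
      fun i j h => h3 _ _ (θ.monotone h), fun i j k h h' => h4 _ _ _ (θ.monotone h) (θ.monotone h'),
      fun i j k l h h' h'' => h5 _ _ _ _ (θ.monotone h) (θ.monotone h') (θ.monotone h'')⟩⟩
  map_add' _ _ := rfl
  map_smul' _ _ := rfl

/-- The simplicial vector space of a 3-term complex. -/
def cochainVS : SimplicialVS.{u} where
  obj Δ := ModuleCat.of ℝ (cochains d₁ d₂ Δ.unop.len)
  map f := ModuleCat.ofHom (cochainsMap d₁ d₂ f.unop.toOrderHom)
  map_id _ := rfl
  map_comp _ _ := rfl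

variable {d₁ d₂}

/-- The label of a vertex. -/
def vert {n : ℕ} (i : Fin (n + 1)) : cochainVS d₁ d₂ _⦋n⦌ →ₗ[ℝ] W₀ :=
  LinearMap.proj i ∘ₗ LinearMap.fst ℝ _ _ ∘ₗ (cochains d₁ d₂ n).subtype

/-- The label of an edge. -/
def edge {n : ℕ} (i j : Fin (n + 1)) : cochainVS d₁ d₂ _⦋n⦌ →ₗ[ℝ] W₁ :=
  LinearMap.proj j ∘ₗ LinearMap.proj i ∘ₗ LinearMap.fst ℝ _ _ ∘ₗ LinearMap.snd ℝ _ _ ∘ₗ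
    (cochains d₁ d₂ n).subtype

/-- The label of a triangle. -/
def tri {n : ℕ} (i j k : Fin (n + 1)) : cochainVS d₁ d₂ _⦋n⦌ →ₗ[ℝ] W₂ :=
  LinearMap.proj k ∘ₗ LinearMap.proj j ∘ₗ LinearMap.proj i ∘ₗ LinearMap.snd ℝ _ _ ∘ₗ
    LinearMap.snd ℝ _ _ ∘ₗ (cochains d₁ d₂ n).subtype

theorem cochain_ext {n : ℕ} {x y : cochainVS d₁ d₂ _⦋n⦌} (h₀ : ∀ i, vert i x = vert i y)
    (h₁ : ∀ i j, edge i j x = edge i j y) (h₂ : ∀ i j k, tri i j k x = tri i j k y) : x = y :=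
  Subtype.ext (Prod.ext (funext h₀) (Prod.ext (funext fun i => funext (h₁ i))
    (funext fun i => funext fun j => funext (h₂ i j))))

section Relations

variable {n : ℕ} (x : cochainVS d₁ d₂ _⦋n⦌)

theorem edge_eq_zero {i j : Fin (n + 1)} (h : ¬ i < j) : edge i j x = 0 := x.2.1 i j h

theorem tri_eq_zero {i j k : Fin (n + 1)} (h : ¬ (i < j ∧ j < k)) : tri i j k x = 0 :=
  x.2.2.1 i j k h

theorem edge_self (i : Fin (n + 1)) : edge i i x = 0 := edge_eq_zero x (lt_irrefl i)

theorem tri_self_left (i j : Fin (n + 1)) : tri i i j x = 0 :=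
  tri_eq_zero x fun h => lt_irrefl i h.1

theorem tri_self_right (i j : Fin (n + 1)) : tri i j j x = 0 :=
  tri_eq_zero x fun h => lt_irrefl j h.2

theorem d₁_edge {i j : Fin (n + 1)} (h : i ≤ j) : d₁ (edge i j x) = vert j x - vert i x :=
  x.2.2.2.1 i j h

theorem d₂_tri {i j k : Fin (n + 1)} (h : i ≤ j) (h' : j ≤ k) :
    d₂ (tri i j k x) = edge i j x + edge j k x - edge i k x := x.2.2.2.2.1 i j k h h'

theorem tri_cocycle {i j k l : Fin (n + 1)} (h : i ≤ j) (h' : j ≤ k) (h'' : k ≤ l) :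
    tri j k l x - tri i k l x + tri i j l x - tri i j k x = 0 :=
  x.2.2.2.2.2 i j k l h h' h''

end Relations

theorem vert_face {n : ℕ} (i : Fin (n + 2)) (j : Fin (n + 1)) (x : cochainVS d₁ d₂ _⦋n + 1⦌) :
    vert j (face (cochainVS d₁ d₂) i x) = vert (i.succAbove j) x := rfl

theorem edge_face {n : ℕ} (i : Fin (n + 2)) (j k : Fin (n + 1)) (x : cochainVS d₁ d₂ _⦋n + 1⦌) :
    edge j k (face (cochainVS d₁ d₂) i x) = edge (i.succAbove j) (i.succAbove k) x := rfl

theorem tri_face {n : ℕ} (i : Fin (n + 2)) (j k l : Fin (n + 1)) (x : cochainVS d₁ d₂ _⦋n + 1⦌) :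
    tri j k l (face (cochainVS d₁ d₂) i x)
      = tri (i.succAbove j) (i.succAbove k) (i.succAbove l) x := rfl

/-- Above degree 2, all labels can be read off from the faces other than the `k`-th. -/
theorem cochain_eq_zero_of_faces {q : ℕ} (hq : 2 < q + 1) (k : Fin (q + 2))
    (y : cochainVS d₁ d₂ _⦋q + 1⦌)
    (hy : ∀ i, i ≠ k → face (cochainVS d₁ d₂) i y = 0) : y = 0 := by
  -- There are at least four vertices, so every edge, and every triangle through `k`, lies in a face
  -- other than the `k`-th.
  have avoid : ∀ a b : Fin (q + 2), ∃ m, m ≠ k ∧ m ≠ a ∧ m ≠ b := fun a b => by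
    obtain ⟨m, -, hm⟩ := Finset.exists_mem_notMem_of_card_lt_card
      (s := ({k, a, b} : Finset (Fin (q + 2)))) (t := Finset.univ)
      (lt_of_le_of_lt Finset.card_le_three (by rw [Finset.card_univ, Fintype.card_fin]; omega))
    exact ⟨m, by simpa using hm⟩
  have hE : ∀ i j, edge i j y = 0 := fun i j => by
    obtain ⟨m, hk, hi, hj⟩ := avoid i j
    obtain ⟨i, rfl⟩ := Fin.exists_succAbove_eq hi.symm
    obtain ⟨j, rfl⟩ := Fin.exists_succAbove_eq hj.symm
    rw [← edge_face, hy m hk, map_zero]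
  have hT : ∀ i j l, i = k ∨ j = k ∨ l = k → tri i j l y = 0 := fun i j l h => by
    obtain ⟨m, hi, hj, hl, hk⟩ : ∃ m, m ≠ i ∧ m ≠ j ∧ m ≠ l ∧ m ≠ k := by
      rcases h with rfl | rfl | rfl
      · obtain ⟨m, h⟩ := avoid j l
        exact ⟨m, h.1, h.2.1, h.2.2, h.1⟩
      · obtain ⟨m, h⟩ := avoid i l
        exact ⟨m, h.2.1, h.1, h.2.2, h.1⟩
      · obtain ⟨m, h⟩ := avoid i j
        exact ⟨m, h.2.1, h.2.2, h.1, h.1⟩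
    obtain ⟨i, rfl⟩ := Fin.exists_succAbove_eq hi.symm
    obtain ⟨j, rfl⟩ := Fin.exists_succAbove_eq hj.symm
    obtain ⟨l, rfl⟩ := Fin.exists_succAbove_eq hl.symm
    rw [← tri_face, hy m hk, map_zero]
  refine cochain_ext (fun i => ?_) (fun i j => by rw [hE, map_zero]) fun i j l => ?_
  · obtain ⟨m, hk, hi, -⟩ := avoid i i
    obtain ⟨i, rfl⟩ := Fin.exists_succAbove_eq hi.symm
    rw [← vert_face, hy m hk, map_zero, map_zero]
  · rw [map_zero]
    by_cases hijl : i < j ∧ j < l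
    -- Insert `k` at its place in the order: in the cocycle relation the three other triangles
    -- contain `k` and vanish.
    · obtain ⟨hij, hjl⟩ := hijl
      rcases le_total k i with h | h
      · have := tri_cocycle y h hij.le hjl.le
        simpa [hT] using this
      rcases le_total k j with h' | h'
      · have := tri_cocycle y h h' hjl.le
        simpa [hT] using this
      rcases le_total k l with h'' | h''
      · have := tri_cocycle y hij.le h' h''
        simpa [hT] using this
      · have := tri_cocycle y hij.le hjl.le h''
        simpa [hT] using this
    · exact tri_eq_zero y hijl

theorem isLinearGroupoid_cochainVS [FiniteDimensional ℝ W₀] [FiniteDimensional ℝ W₁]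
    [FiniteDimensional ℝ W₂] : IsLinearGroupoid 2 (cochainVS d₁ d₂) :=
  isLinearGroupoid_of_faces
    (fun q => inferInstanceAs (FiniteDimensional ℝ (cochains d₁ d₂ q)))
    fun _ hq k y hy => cochain_eq_zero_of_faces hq k y hy

/-! The levels of the associated complex. -/

theorem vert_bijective : Function.Bijective (vert (d₁ := d₁) (d₂ := d₂) (n := 0) 0) := by
  constructor
  · intro x y h
    refine cochain_ext (fun i => ?_) (fun i j => ?_) fun i j k => ?_
    · rwa [Subsingleton.elim (α := Fin 1) i 0]
    · rw [edge_eq_zero, edge_eq_zero] <;> simp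
    · rw [tri_eq_zero, tri_eq_zero] <;> simp
  · intro v
    refine ⟨⟨(fun _ => v, 0, 0), ?_⟩, rfl⟩
    simp [cochains]

theorem fin_two_of_lt : ∀ i j : Fin 2, i < j → i = 0 ∧ j = 1 := by decide

theorem fin_three_of_lt : ∀ i j : Fin 3, i < j → (i = 0 ∧ j = 1) ∨ (i = 0 ∧ j = 2) ∨
    (i = 1 ∧ j = 2) := by decide

theorem fin_three_of_lt_lt : ∀ i j k : Fin 3, i < j ∧ j < k → i = 0 ∧ j = 1 ∧ k = 2 := by decide

theorem fin_three_of_le_le : ∀ i j k : Fin 3, i ≤ j → j ≤ k →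
    i = j ∨ j = k ∨ i = 0 ∧ j = 1 ∧ k = 2 := by decide

theorem fin_three_of_le_le_le : ∀ i j k l : Fin 3, i ≤ j → j ≤ k → k ≤ l →
    i = j ∨ j = k ∨ k = l := by decide

theorem vert_one_of_mem (w : cplx1 (cochainVS d₁ d₂)) : vert 1 (w : cochainVS d₁ d₂ _⦋1⦌) = 0 :=
  congrArg (vert 0) (show face (cochainVS d₁ d₂) (q := 0) 0 w.1 = 0 from w.2)

theorem edge_bijective : Function.Bijective
    (edge (d₁ := d₁) (d₂ := d₂) (n := 1) 0 1 ∘ₗ (cplx1 (cochainVS d₁ d₂)).subtype) := by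
  constructor
  · rw [injective_iff_map_eq_zero]
    intro x hx
    replace hx : edge 0 1 (x : cochainVS d₁ d₂ _⦋1⦌) = 0 := hx
    have h1 := vert_one_of_mem x
    have h0 := d₁_edge (x : cochainVS d₁ d₂ _⦋1⦌) (i := 0) (j := 1) (by decide)
    rw [hx, map_zero, h1, zero_sub, eq_comm, neg_eq_zero] at h0
    refine Subtype.ext (cochain_ext (Fin.forall_fin_two.2 ⟨h0, h1⟩) (fun i j => ?_) fun i j k => ?_)
    · by_cases h : i < j
      · obtain ⟨rfl, rfl⟩ := fin_two_of_lt i j h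
        exact hx
      · rw [edge_eq_zero _ h, edge_eq_zero _ h]
    · rw [tri_eq_zero, tri_eq_zero] <;> omega
  · intro w
    -- `f_0` retains vertex 1, whose label is therefore 0; the edge relation then forces `-d₁ w` at
    -- vertex 0.
    refine ⟨⟨⟨(fun i => if i = 0 then -d₁ w else 0, fun i j => if i < j then w else 0, 0),
      fun i j h => if_neg h, fun _ _ _ _ => rfl, ?_, ?_, fun _ _ _ _ _ _ _ => by simp⟩, ?_⟩, rfl⟩
    · intro i j _
      fin_cases i <;> fin_cases j <;> simp_all
    · intro i j k h h'
      fin_cases i <;> fin_cases j <;> fin_cases k <;> simp_all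
    · refine cochain_ext (fun i => rfl) (fun i j => ?_) fun i j k => rfl
      rw [edge_eq_zero, edge_eq_zero] <;> omega

theorem tri_bijective (hd : d₁ ∘ₗ d₂ = 0) : Function.Bijective
    (tri (d₁ := d₁) (d₂ := d₂) (n := 2) 0 1 2 ∘ₗ (cplx2 (cochainVS d₁ d₂)).subtype) := by
  constructor
  · rw [injective_iff_map_eq_zero]
    intro x hx
    replace hx : tri 0 1 2 (x : cochainVS d₁ d₂ _⦋2⦌) = 0 := hx
    have f0 := face_zero_of_mem₂ x
    have f1 := face_one_of_mem₂ x
    have h1 : vert 1 (x : cochainVS d₁ d₂ _⦋2⦌) = 0 := congrArg (vert 0) f0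
    have h2 : vert 2 (x : cochainVS d₁ d₂ _⦋2⦌) = 0 := congrArg (vert 1) f0
    have h0 : vert 0 (x : cochainVS d₁ d₂ _⦋2⦌) = 0 := congrArg (vert 0) f1
    have h12 : edge 1 2 (x : cochainVS d₁ d₂ _⦋2⦌) = 0 := congrArg (edge 0 1) f0
    have h02 : edge 0 2 (x : cochainVS d₁ d₂ _⦋2⦌) = 0 := congrArg (edge 0 1) f1
    have h01 := d₂_tri (x : cochainVS d₁ d₂ _⦋2⦌) (i := 0) (j := 1) (k := 2) (by decide) (by decide)
    rw [hx, map_zero, h12, h02, add_zero, sub_zero] at h01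
    refine Subtype.ext (cochain_ext (fun i => ?_) (fun i j => ?_) fun i j k => ?_)
    · fin_cases i
      exacts [h0, h1, h2]
    · by_cases h : i < j
      · obtain ⟨rfl, rfl⟩ | ⟨rfl, rfl⟩ | ⟨rfl, rfl⟩ :=
          fin_three_of_lt i j h
        exacts [h01.symm, h02, h12]
      · rw [edge_eq_zero _ h, edge_eq_zero _ h]
    · by_cases h : i < j ∧ j < k
      · obtain ⟨rfl, rfl, rfl⟩ := fin_three_of_lt_lt i j k h
        exact hx
      · rw [tri_eq_zero _ h, tri_eq_zero _ h]
  · intro w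
    have hdw : d₁ (d₂ w) = 0 := LinearMap.congr_fun hd w
    -- `f_0 = f_1 = 0` kills every vertex and the edges 12 and 02. The edge 01 is then forced to be
    -- `d₂ w`, and its own relation is `d₁ (d₂ w) = 0`.
    refine ⟨⟨⟨(0, fun i j => if i = 0 ∧ j = 1 then d₂ w else 0,
      fun i j k => if i = 0 ∧ j = 1 ∧ k = 2 then w else 0), ?_, ?_, ?_, ?_, ?_⟩, ?_⟩, rfl⟩
    · rintro i j h
      refine if_neg ?_
      rintro ⟨rfl, rfl⟩
      exact h (by decide)
    · rintro i j k h
      refine if_neg ?_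
      rintro ⟨rfl, rfl, rfl⟩
      exact h (by decide)
    · intro i j h
      dsimp only
      split_ifs <;> simp [hdw]
    · intro i j k h h'
      obtain rfl | rfl | ⟨rfl, rfl, rfl⟩ := fin_three_of_le_le i j k h h'
      · have : ¬ (i = 0 ∧ i = 1) := by rintro ⟨rfl, h⟩; exact absurd h (by decide)
        simp [← and_assoc, this]
      · have : ¬ (j = 1 ∧ j = 2) := by rintro ⟨rfl, h⟩; exact absurd h (by decide)
        by_cases hj : j = 0
        · subst hj
          simp
        · simp [this, hj]
      · simp
    · intro i j k l h h' h''
      have h01 : ∀ a : Fin 3, ¬ (a = 0 ∧ a = 1) := by decide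
      have h12 : ∀ a : Fin 3, ¬ (a = 1 ∧ a = 2) := by decide
      obtain rfl | rfl | rfl := fin_three_of_le_le_le i j k l h h' h''
      · have := h01 i
        simp [← and_assoc, this]
      · have := h01 j
        have := h12 j
        simp [← and_assoc, this]
        simp_all
      · have := h12 k
        simp [this]
    · constructor <;> refine cochain_ext (fun i => rfl) (fun i j => ?_) fun i j k => ?_
      · fin_cases i <;> fin_cases j <;> rfl
      · rw [tri_eq_zero, tri_eq_zero] <;> omega
      · fin_cases i <;> fin_cases j <;> rfl
      · rw [tri_eq_zero, tri_eq_zero] <;> omega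

end Cochains

/-! ### The constant symplectic 2-groupoid of a tuple -/

theorem form_adjointMap {W₁ W₀ : Type u} [AddCommGroup W₁] [Module ℝ W₁]
    [FiniteDimensional ℝ W₁] [AddCommGroup W₀] [Module ℝ W₀] (b : LinearMap.BilinForm ℝ W₁)
    (hb : b.Nondegenerate) (d : W₁ →ₗ[ℝ] W₀) (ξ : Module.Dual ℝ W₀) (u : W₁) :
    b (adjointMap b hb d ξ) u = ξ (d u) :=
  LinearMap.BilinForm.apply_toDual_symm_apply (hB := hb) (d.dualMap ξ) u

namespace LinearData

variable (T : LinearData.{u})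

theorem form_bdryStar (ξ : Module.Dual ℝ T.W₀) (u : T.W₁) :
    T.form (T.bdryStar ξ) u = ξ (T.bdry u) :=
  form_adjointMap _ _ _ _ _

theorem form_comm (x y : T.W₁) : T.form x y = T.form y x := T.form_symm.eq x y

theorem r_neg (x y : T.W₁) : -T.r x y = T.r y x := LinearMap.BilinForm.IsAlt.neg_eq T.r_isAlt x y

/-- Isotropy is equivalent to this, as `η (∂ ∂^* ξ) = ⟨∂^* η, ∂^* ξ⟩`; it makes the tuple a complex.
-/
theorem bdry_comp_bdryStar : T.bdry ∘ₗ T.bdryStar = 0 := by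
  ext ξ
  rw [LinearMap.comp_apply, LinearMap.zero_apply, ← Module.forall_dual_apply_eq_zero_iff ℝ]
  intro η
  rw [← form_bdryStar]
  exact T.isotropic _ ⟨η, rfl⟩ _ ⟨ξ, rfl⟩

/-- The simplicial vector space of a tuple. -/
noncomputable abbrev model : SimplicialVS.{u} := cochainVS T.bdry T.bdryStar

/-- The 2-form on the simplicial vector space of a tuple. -/
noncomputable def modelForm : LinearMap.BilinForm ℝ (T.model _⦋2⦌) :=
  LinearMap.mk₂ ℝ (fun x y =>
      -- The `r` terms are minus the simplicial coboundary of `r` on edges. The rest is a skew cup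
      -- product of edge labels, corrected by pairing triangles with vertices because edge labels
      -- are additive only up to `∂^*` of triangles.
      T.r (edge 0 2 x) (edge 0 2 y) - T.r (edge 0 1 x) (edge 0 1 y) - T.r (edge 1 2 x) (edge 1 2 y)
      + 1 / 2 * (T.form (edge 0 1 x) (edge 1 2 y) - T.form (edge 0 1 y) (edge 1 2 x)
        + tri 0 1 2 y (vert 0 x + vert 2 x) - tri 0 1 2 x (vert 0 y + vert 2 y)))
    (fun x x' y => by simp only [map_add, LinearMap.add_apply]; ring)
    (fun c x y => by
      simp only [map_smul, LinearMap.smul_apply, smul_eq_mul, ← smul_add]; ring)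
    (fun x x' y => by simp only [map_add, LinearMap.add_apply]; ring)
    (fun c x y => by
      simp only [map_smul, LinearMap.smul_apply, smul_eq_mul, ← smul_add]; ring)

theorem modelForm_apply (x y : T.model _⦋2⦌) : T.modelForm x y =
    T.r (edge 0 2 x) (edge 0 2 y) - T.r (edge 0 1 x) (edge 0 1 y) - T.r (edge 1 2 x) (edge 1 2 y)
      + 1 / 2 * (T.form (edge 0 1 x) (edge 1 2 y) - T.form (edge 0 1 y) (edge 1 2 x)
        + tri 0 1 2 y (vert 0 x + vert 2 x) - tri 0 1 2 x (vert 0 y + vert 2 y)) := rfl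

theorem modelForm_isAlt : T.modelForm.IsAlt := by
  intro x
  rw [modelForm_apply, LinearMap.BilinForm.IsAlt.self_eq_zero T.r_isAlt,
    LinearMap.BilinForm.IsAlt.self_eq_zero T.r_isAlt,
    LinearMap.BilinForm.IsAlt.self_eq_zero T.r_isAlt]
  ring

/-- The defect of additivity of edges is `∂^* τ` for the triangle label `τ`, and `⟨∂^* τ, e⟩ = τ (∂
e)`. -/
theorem form_edge_sub {n : ℕ} (x y : T.model _⦋n⦌) {i j k l m : Fin (n + 1)} (h : i ≤ j)
    (h' : j ≤ k) (h'' : l ≤ m) :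
    T.form (edge i j x) (edge l m y) + T.form (edge j k x) (edge l m y)
      - T.form (edge i k x) (edge l m y) = tri i j k x (vert m y) - tri i j k x (vert l y) := by
  rw [← LinearMap.add_apply, ← map_add, ← LinearMap.sub_apply, ← map_sub, ← d₂_tri x h h',
    form_bdryStar, d₁_edge y h'', map_sub]

theorem modelForm_isMultiplicative : IsMultiplicative T.model (q := 2) T.modelForm := by
  refine isMultiplicative_iff.2 fun x y => ?_
  -- The face `f_i` omits vertex `i`, so the four groups concern the triangles 123, 023, 013, 012;
  -- their `r` terms cancel in pairs.
  change (
    (T.r (edge 1 3 x) (edge 1 3 y) - T.r (edge 1 2 x) (edge 1 2 y) - T.r (edge 2 3 x) (edge 2 3 y)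
      + 1 / 2 * (T.form (edge 1 2 x) (edge 2 3 y) - T.form (edge 1 2 y) (edge 2 3 x)
        + tri 1 2 3 y (vert 1 x + vert 3 x) - tri 1 2 3 x (vert 1 y + vert 3 y)))
    - (T.r (edge 0 3 x) (edge 0 3 y) - T.r (edge 0 2 x) (edge 0 2 y) - T.r (edge 2 3 x) (edge 2 3 y)
      + 1 / 2 * (T.form (edge 0 2 x) (edge 2 3 y) - T.form (edge 0 2 y) (edge 2 3 x)
        + tri 0 2 3 y (vert 0 x + vert 3 x) - tri 0 2 3 x (vert 0 y + vert 3 y)))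
    + (T.r (edge 0 3 x) (edge 0 3 y) - T.r (edge 0 1 x) (edge 0 1 y) - T.r (edge 1 3 x) (edge 1 3 y)
      + 1 / 2 * (T.form (edge 0 1 x) (edge 1 3 y) - T.form (edge 0 1 y) (edge 1 3 x)
        + tri 0 1 3 y (vert 0 x + vert 3 x) - tri 0 1 3 x (vert 0 y + vert 3 y)))
    - (T.r (edge 0 2 x) (edge 0 2 y) - T.r (edge 0 1 x) (edge 0 1 y) - T.r (edge 1 2 x) (edge 1 2 y)
      + 1 / 2 * (T.form (edge 0 1 x) (edge 1 2 y) - T.form (edge 0 1 y) (edge 1 2 x)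
        + tri 0 1 2 y (vert 0 x + vert 2 x) - tri 0 1 2 x (vert 0 y + vert 2 y))) : ℝ) = 0
  have c (z : T.model _⦋3⦌) (v : T.W₀) : tri 1 2 3 z v - tri 0 2 3 z v + tri 0 1 3 z v
      - tri 0 1 2 z v = 0 :=
    LinearMap.congr_fun (tri_cocycle z (i := 0) (j := 1) (k := 2) (l := 3) (by decide) (by decide)
      (by decide)) v
  have h1 (z z' : T.model _⦋3⦌) := T.form_edge_sub z z' (i := 0) (j := 1) (k := 2) (l := 2) (m := 3)
    (by decide) (by decide) (by decide)
  have h2 (z z' : T.model _⦋3⦌) := T.form_edge_sub z z' (i := 1) (j := 2) (k := 3) (l := 0) (m := 1)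
    (by decide) (by decide) (by decide)
  have h1xy := h1 x y
  have h1yx := h1 y x
  have h2xy := h2 x y
  have h2yx := h2 y x
  -- Symmetry of the form brings all products into a common order before the linear combination.
  simp only [T.form_comm _ (edge 0 1 x), T.form_comm _ (edge 0 1 y)] at h2xy h2yx
  simp only [T.form_comm (edge 0 1 x), T.form_comm (edge 0 1 y)] at h2xy h2yx h1xy h1yx ⊢
  simp only [map_add]
  linear_combination 1 / 2 * (h1xy - h1yx - h2yx + h2xy - c x (vert 0 y) - c x (vert 3 y)
    + c y (vert 0 x) + c y (vert 3 x))

theorem modelForm_isNormalized : IsNormalized T.model (q := 1) T.modelForm := by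
  intro i
  refine LinearMap.ext fun x => LinearMap.ext fun y => ?_
  change T.modelForm (degen T.model (q := 1) i x) (degen T.model (q := 1) i y) = 0
  fin_cases i
  · change T.r (edge 0 1 x) (edge 0 1 y) - T.r (edge 0 0 x) (edge 0 0 y)
      - T.r (edge 0 1 x) (edge 0 1 y)
      + 1 / 2 * (T.form (edge 0 0 x) (edge 0 1 y) - T.form (edge 0 0 y) (edge 0 1 x)
        + tri 0 0 1 y (vert 0 x + vert 1 x) - tri 0 0 1 x (vert 0 y + vert 1 y)) = 0
    simp [edge_self, tri_self_left]
  · change T.r (edge 0 1 x) (edge 0 1 y) - T.r (edge 0 1 x) (edge 0 1 y)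
      - T.r (edge 1 1 x) (edge 1 1 y)
      + 1 / 2 * (T.form (edge 0 1 x) (edge 1 1 y) - T.form (edge 0 1 y) (edge 1 1 x)
        + tri 0 1 1 y (vert 0 x + vert 1 x) - tri 0 1 1 x (vert 0 y + vert 1 y)) = 0
    simp [edge_self, tri_self_right]

/-- A constant triangle has zero edge and triangle labels, and its vertices 0 and 2 both contribute
`v`, which cancels the factor 1/2. -/
theorem modelForm_unit (v : T.model _⦋0⦌) (w : T.model _⦋2⦌) :
    T.modelForm (degen T.model (q := 1) 0 (degen T.model (q := 0) 0 v)) w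
      = tri 0 1 2 w (vert 0 v) := by
  change T.r (edge 0 0 v) (edge 0 2 w) - T.r (edge 0 0 v) (edge 0 1 w)
      - T.r (edge 0 0 v) (edge 1 2 w)
      + 1 / 2 * (T.form (edge 0 0 v) (edge 1 2 w) - T.form (edge 0 1 w) (edge 0 0 v)
        + tri 0 1 2 w (vert 0 v + vert 0 v) - tri 0 0 0 v (vert 0 w + vert 2 w)) = _
  simp [edge_self, tri_self_left]
  ring

/-- `σ_1 x` has zero edge 12 and `σ_0 y` has zero edge 01, so only the `r` term on edges 02 and one
cup product survive. -/
theorem modelForm_degen_degen (x y : T.model _⦋1⦌) :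
    T.modelForm (degen T.model (q := 1) 1 x) (degen T.model (q := 1) 0 y)
      = 1 / 2 * T.form (edge 0 1 x) (edge 0 1 y) + T.r (edge 0 1 x) (edge 0 1 y) := by
  change T.r (edge 0 1 x) (edge 0 1 y) - T.r (edge 0 1 x) (edge 0 0 y)
      - T.r (edge 1 1 x) (edge 0 1 y)
      + 1 / 2 * (T.form (edge 0 1 x) (edge 0 1 y) - T.form (edge 0 0 y) (edge 1 1 x)
        + tri 0 0 1 y (vert 0 x + vert 1 x) - tri 0 1 1 x (vert 0 y + vert 1 y)) = _
  simp [edge_self, tri_self_left, tri_self_right]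
  ring

/-- The identification of `W_0`. -/
noncomputable def modelEquiv0 : cplx0 T.model ≃ₗ[ℝ] T.W₀ :=
  LinearEquiv.ofBijective _ vert_bijective

/-- The identification of `W_1`. -/
noncomputable def modelEquiv1 : cplx1 T.model ≃ₗ[ℝ] T.W₁ :=
  LinearEquiv.ofBijective _ edge_bijective

/-- The identification of `W_2`. -/
noncomputable def modelEquiv2 : cplx2 T.model ≃ₗ[ℝ] Module.Dual ℝ T.W₀ :=
  LinearEquiv.ofBijective _ (tri_bijective T.bdry_comp_bdryStar)

theorem modelEquiv0_apply (v : cplx0 T.model) : T.modelEquiv0 v = vert 0 v := rfl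

theorem modelEquiv1_apply (w : cplx1 T.model) :
    T.modelEquiv1 w = edge 0 1 (w : T.model _⦋1⦌) := rfl

theorem modelEquiv2_apply (w : cplx2 T.model) :
    T.modelEquiv2 w = tri 0 1 2 (w : T.model _⦋2⦌) := rfl

theorem edge_proj1 (x : T.model _⦋1⦌) : edge 0 1 (proj1 T.model x : T.model _⦋1⦌) = edge 0 1 x := by
  rw [proj1_coe, map_sub]
  change _ - edge 0 0 (face T.model (q := 0) 0 x) = _
  rw [edge_self, sub_zero]

theorem tri_proj2 (x : T.model _⦋2⦌) :
    tri 0 1 2 (proj2 T.model x : T.model _⦋2⦌) = tri 0 1 2 x := by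
  rw [proj2_coe, map_sub, map_sub]
  change _ - tri 0 0 1 (face T.model (q := 1) 0 x)
    - tri 0 1 1 (face T.model (q := 1) 1 x - face T.model (q := 1) 0 x) = _
  rw [tri_self_left, tri_self_right, sub_zero, sub_zero]

theorem modelForm_nondegenerate_A :
    (pairingA T.model T.modelForm T.modelForm_isNormalized).Nondegenerate := by
  constructor
  · intro v hv
    refine T.modelEquiv0.map_eq_zero_iff.1 ?_
    rw [← Module.forall_dual_apply_eq_zero_iff ℝ]
    intro ξ
    obtain ⟨w, rfl⟩ := T.modelEquiv2.surjective ξ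
    rw [modelEquiv2_apply, modelEquiv0_apply, ← modelForm_unit]
    exact hv (Submodule.Quotient.mk w.1)
  · intro w hw
    obtain ⟨w, rfl⟩ := Submodule.Quotient.mk_surjective _ w
    have h : proj2 T.model w = 0 := by
      refine T.modelEquiv2.map_eq_zero_iff.1 (LinearMap.ext fun v => ?_)
      obtain ⟨v, rfl⟩ := T.modelEquiv0.surjective v
      rw [modelEquiv2_apply, tri_proj2, modelEquiv0_apply, ← modelForm_unit]
      exact hw v
    rw [Submodule.Quotient.mk_eq_zero]
    have := proj2_mem_degenerate T.model w
    rwa [h, Submodule.coe_zero, sub_zero] at this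

/-- Symmetrizing C₃₂ doubles `½ ⟨·,·⟩` and cancels `r`. -/
theorem modelForm_nondegenerate_B :
    (pairingB T.model T.modelForm T.modelForm_isNormalized).Nondegenerate := by
  have key : ∀ x y : T.model _⦋1⦌,
      pairingB T.model T.modelForm T.modelForm_isNormalized (Submodule.Quotient.mk x)
        (Submodule.Quotient.mk y) = T.form (edge 0 1 x) (edge 0 1 y) := fun x y => by
    rw [pairingB_mk, modelForm_degen_degen, modelForm_degen_degen, ← T.r_neg (edge 0 1 x),
      T.form_comm (edge 0 1 y)]
    ring
  have left : (pairingB T.model T.modelForm T.modelForm_isNormalized).SeparatingLeft := by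
    intro x hx
    obtain ⟨x, rfl⟩ := Submodule.Quotient.mk_surjective _ x
    have h : proj1 T.model x = 0 := by
      refine T.modelEquiv1.map_eq_zero_iff.1 (T.form_nondegenerate.1 _ fun v => ?_)
      obtain ⟨v, rfl⟩ := T.modelEquiv1.surjective v
      rw [modelEquiv1_apply, edge_proj1, modelEquiv1_apply, ← key]
      exact hx _
    rw [Submodule.Quotient.mk_eq_zero]
    have := proj1_mem_degenerate T.model x
    rwa [h, Submodule.coe_zero, sub_zero] at this
  refine ⟨left, fun y hy => left y fun x => ?_⟩
  obtain ⟨x, rfl⟩ := Submodule.Quotient.mk_surjective _ x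
  obtain ⟨y, rfl⟩ := Submodule.Quotient.mk_surjective _ y
  rw [key, T.form_comm, ← key]
  exact hy _

/-- The constant symplectic 2-groupoid of a tuple. -/
noncomputable def groupoid : ConstSymp2Groupoid.{u} where
  V := T.model
  isLinearGroupoid := isLinearGroupoid_cochainVS
  ω := T.modelForm
  isAlt := T.modelForm_isAlt
  isMultiplicative := T.modelForm_isMultiplicative
  isNormalized := T.modelForm_isNormalized
  nondegenerate_A := T.modelForm_nondegenerate_A
  nondegenerate_B := T.modelForm_nondegenerate_B

end LinearData

/-! ### The components C₄₁ and C₃₂ through degeneracies. -/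

theorem C41_eq (X : ConstSymp2Groupoid.{u}) (v : cplx0 X.V) (w : cplx2 X.V) :
    C41 X v w = X.ω (degen X.V (q := 1) 0 (degen X.V (q := 0) 0 v)) w.1 := by
  simp [C41, assemble]

/-- The second argument assembles to `σ_0 u' - σ_1 u'`; normalization removes the second term. -/
theorem C32_eq (X : ConstSymp2Groupoid.{u}) (u u' : cplx1 X.V) :
    C32 X u u' = X.ω (degen X.V (q := 1) 1 u.1) (degen X.V (q := 1) 0 u'.1) := by
  simp [C32, assemble, X.isNormalized.apply 1]

namespace LinearData

/-- The presentation of the constant symplectic 2-groupoid of a tuple by that tuple. -/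
noncomputable def presentation (T : LinearData.{u}) : Presentation T.groupoid T where
  e₀ := T.modelEquiv0
  e₁ := T.modelEquiv1
  e₂ := T.modelEquiv2
  map_bdry1 (w : cplx1 T.model) := by
    have h := d₁_edge (w : T.model _⦋1⦌) (i := 0) (j := 1) (by decide)
    rw [vert_one_of_mem, zero_sub] at h
    exact h.symm
  map_bdry2 (w : cplx2 T.model) := by
    have h := d₂_tri (w : T.model _⦋2⦌) (i := 0) (j := 1) (k := 2) (by decide) (by decide)
    have h12 : edge 1 2 (w : T.model _⦋2⦌) = 0 := congrArg (edge 0 1) (face_zero_of_mem₂ w)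
    have h02 : edge 0 2 (w : T.model _⦋2⦌) = 0 := congrArg (edge 0 1) (face_one_of_mem₂ w)
    rw [h12, h02, add_zero, sub_zero] at h
    exact h.symm
  map_C41 v w := (C41_eq _ v w).trans (T.modelForm_unit v w.1)
  map_C32 u u' := (C32_eq _ u u').trans (T.modelForm_degen_degen u.1 u'.1)

end LinearData

/-! ### Maps into the simplicial vector space of a complex -/

section ToCochains

/-- Restriction of simplices along a map of the simplex category. -/
abbrev pull (V : SimplicialVS.{u}) {m n : ℕ} (θ : ⦋m⦌ ⟶ ⦋n⦌) : V _⦋n⦌ →ₗ[ℝ] V _⦋m⦌ :=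
  (V.map θ.op).hom

theorem pull_pull (V : SimplicialVS.{u}) {l m n : ℕ} (η : ⦋l⦌ ⟶ ⦋m⦌) (θ : ⦋m⦌ ⟶ ⦋n⦌)
    (x : V _⦋n⦌) : pull V η (pull V θ x) = pull V (η ≫ θ) x :=
  (congrArg (fun f => f.hom x) (V.map_comp θ.op η.op)).symm

theorem face_pull (V : SimplicialVS.{u}) {m n : ℕ} (i : Fin (m + 2)) (θ : ⦋m + 1⦌ ⟶ ⦋n⦌)
    (x : V _⦋n⦌) : face V i (pull V θ x) = pull V (SimplexCategory.δ i ≫ θ) x :=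
  pull_pull V _ θ x

theorem pull_degen (V : SimplicialVS.{u}) {m n : ℕ} (i : Fin (m + 1)) (θ : ⦋m⦌ ⟶ ⦋n⦌)
    (x : V _⦋n⦌) : pull V (SimplexCategory.σ i ≫ θ) x = degen V i (pull V θ x) :=
  (pull_pull V _ θ x).symm

/-- The map of the simplex category that picks out four vertices. -/
def mkOfLeLeLe {n : ℕ} (i j k l : Fin (n + 1)) (h : i ≤ j) (h' : j ≤ k) (h'' : k ≤ l) :
    ⦋3⦌ ⟶ ⦋n⦌ :=
  SimplexCategory.mkHom
    { toFun := ![i, j, k, l]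
      monotone' := by
        rw [Fin.monotone_iff_le_succ]
        intro a
        fin_cases a
        exacts [h, h', h''] }

open SimplexCategory in
-- These face relations carry the identities for `proj1` and `proj2` over to the edges, triangles
-- and tetrahedra of an arbitrary simplex.
theorem δ_mkOfLe {n : ℕ} (i j : Fin (n + 1)) (h : i ≤ j) :
    δ 0 ≫ mkOfLe i j h = const ⦋0⦌ ⦋n⦌ j ∧ δ 1 ≫ mkOfLe i j h = const ⦋0⦌ ⦋n⦌ i := by
  constructor <;> ext a <;> fin_cases a <;> rfl

open SimplexCategory in
theorem δ_mkOfLeComp {n : ℕ} (i j k : Fin (n + 1)) (h : i ≤ j) (h' : j ≤ k) :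
    δ 0 ≫ mkOfLeComp i j k h h' = mkOfLe j k h' ∧
    δ 1 ≫ mkOfLeComp i j k h h' = mkOfLe i k (h.trans h') ∧
    δ 2 ≫ mkOfLeComp i j k h h' = mkOfLe i j h := by
  refine ⟨?_, ?_, ?_⟩ <;> ext a <;> fin_cases a <;> rfl

open SimplexCategory in
theorem δ_mkOfLeLeLe {n : ℕ} (i j k l : Fin (n + 1)) (h : i ≤ j) (h' : j ≤ k) (h'' : k ≤ l) :
    δ 0 ≫ mkOfLeLeLe i j k l h h' h'' = mkOfLeComp j k l h' h'' ∧
    δ 1 ≫ mkOfLeLeLe i j k l h h' h'' = mkOfLeComp i k l (h.trans h') h'' ∧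
    δ 2 ≫ mkOfLeLeLe i j k l h h' h'' = mkOfLeComp i j l h (h'.trans h'') ∧
    δ 3 ≫ mkOfLeLeLe i j k l h h' h'' = mkOfLeComp i j k h h' := by
  refine ⟨?_, ?_, ?_, ?_⟩ <;> ext a <;> fin_cases a <;> rfl

open SimplexCategory in
theorem mkOfLe_self {n : ℕ} (i : Fin (n + 1)) :
    mkOfLe i i le_rfl = σ 0 ≫ const ⦋0⦌ ⦋n⦌ i := by
  ext a; fin_cases a <;> rfl

open SimplexCategory in
theorem mkOfLeComp_self_left {n : ℕ} (i j : Fin (n + 1)) (h : i ≤ j) :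
    mkOfLeComp i i j le_rfl h = σ 0 ≫ mkOfLe i j h := by
  ext a; fin_cases a <;> rfl

open SimplexCategory in
theorem mkOfLeComp_self_right {n : ℕ} (i j : Fin (n + 1)) (h : i ≤ j) :
    mkOfLeComp i j j h le_rfl = σ 1 ≫ mkOfLe i j h := by
  ext a; fin_cases a <;> rfl

open SimplexCategory in
theorem mkOfLe_comp {m n : ℕ} (i j : Fin (m + 1)) (h : i ≤ j) (θ : ⦋m⦌ ⟶ ⦋n⦌) :
    mkOfLe i j h ≫ θ = mkOfLe (θ.toOrderHom i) (θ.toOrderHom j) (θ.toOrderHom.monotone h) := by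
  ext a; fin_cases a <;> rfl

open SimplexCategory in
theorem mkOfLeComp_comp {m n : ℕ} (i j k : Fin (m + 1)) (h : i ≤ j) (h' : j ≤ k)
    (θ : ⦋m⦌ ⟶ ⦋n⦌) : mkOfLeComp i j k h h' ≫ θ = mkOfLeComp (θ.toOrderHom i) (θ.toOrderHom j)
      (θ.toOrderHom k) (θ.toOrderHom.monotone h) (θ.toOrderHom.monotone h') := by
  ext a; fin_cases a <;> rfl

/-! ### Labels of the simplices of V. -/

variable {V : SimplicialVS.{u}} {W₀ W₁ W₂ : Type u} [AddCommGroup W₀] [Module ℝ W₀]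
  [AddCommGroup W₁] [Module ℝ W₁] [AddCommGroup W₂] [Module ℝ W₂]
  {d₁ : W₁ →ₗ[ℝ] W₀} {d₂ : W₂ →ₗ[ℝ] W₁}
  (e₀ : cplx0 V →ₗ[ℝ] W₀) (e₁ : cplx1 V →ₗ[ℝ] W₁) (e₂ : cplx2 V →ₗ[ℝ] W₂)

/-- The label of a vertex of a simplex of `V`. -/
def vertMap {n : ℕ} (i : Fin (n + 1)) : V _⦋n⦌ →ₗ[ℝ] W₀ :=
  e₀ ∘ₗ pull V (SimplexCategory.const ⦋0⦌ ⦋n⦌ i)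

/-- The label of an edge of a simplex of `V`. -/
def edgeMap {n : ℕ} (i j : Fin (n + 1)) : V _⦋n⦌ →ₗ[ℝ] W₁ :=
  if h : i ≤ j then e₁ ∘ₗ proj1 V ∘ₗ pull V (SimplexCategory.mkOfLe i j h) else 0

/-- The label of a triangle of a simplex of `V`. -/
def triMap {n : ℕ} (i j k : Fin (n + 1)) : V _⦋n⦌ →ₗ[ℝ] W₂ :=
  if h : i ≤ j ∧ j ≤ k then
    e₂ ∘ₗ proj2 V ∘ₗ pull V (SimplexCategory.mkOfLeComp i j k h.1 h.2) else 0

theorem edgeMap_of_le {n : ℕ} {i j : Fin (n + 1)} (h : i ≤ j) (x : V _⦋n⦌) :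
    edgeMap e₁ i j x = e₁ (proj1 V (pull V (SimplexCategory.mkOfLe i j h) x)) := by
  rw [edgeMap, dif_pos h]
  rfl

theorem triMap_of_le {n : ℕ} {i j k : Fin (n + 1)} (h : i ≤ j) (h' : j ≤ k) (x : V _⦋n⦌) :
    triMap e₂ i j k x = e₂ (proj2 V (pull V (SimplexCategory.mkOfLeComp i j k h h') x)) := by
  rw [triMap, dif_pos ⟨h, h'⟩]
  rfl

/-- For `i = j` the edge is degenerate and `proj1` kills it; for `i > j` zero is the default value.
-/
theorem edgeMap_eq_zero {n : ℕ} {i j : Fin (n + 1)} (h : ¬ i < j) (x : V _⦋n⦌) :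
    edgeMap e₁ i j x = 0 := by
  by_cases hij : i ≤ j
  · obtain rfl : i = j := le_antisymm hij (not_lt.1 h)
    rw [edgeMap_of_le e₁ le_rfl, mkOfLe_self, pull_degen, proj1_degen, map_zero]
  · rw [edgeMap, dif_neg hij, LinearMap.zero_apply]

theorem triMap_eq_zero {n : ℕ} {i j k : Fin (n + 1)} (h : ¬ (i < j ∧ j < k)) (x : V _⦋n⦌) :
    triMap e₂ i j k x = 0 := by
  by_cases hijk : i ≤ j ∧ j ≤ k
  · obtain ⟨hij, hjk⟩ := hijk
    rcases hij.eq_or_lt with rfl | hij'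
    · rw [triMap_of_le e₂ le_rfl hjk, mkOfLeComp_self_left, pull_degen, proj2_degen_zero, map_zero]
    rcases hjk.eq_or_lt with rfl | hjk'
    · rw [triMap_of_le e₂ hij le_rfl, mkOfLeComp_self_right, pull_degen, proj2_degen_one, map_zero]
    exact absurd ⟨hij', hjk'⟩ h
  · rw [triMap, dif_neg hijk, LinearMap.zero_apply]

theorem edgeMap_pull {m n : ℕ} (θ : ⦋m⦌ ⟶ ⦋n⦌) (i j : Fin (m + 1)) (x : V _⦋n⦌) :
    edgeMap e₁ i j (pull V θ x) = edgeMap e₁ (θ.toOrderHom i) (θ.toOrderHom j) x := by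
  by_cases h : i ≤ j
  · rw [edgeMap_of_le e₁ h, edgeMap_of_le e₁ (θ.toOrderHom.monotone h), pull_pull, mkOfLe_comp]
  · rw [edgeMap_eq_zero e₁ fun h' => h h'.le,
      edgeMap_eq_zero e₁ fun h' => h (θ.toOrderHom.monotone.reflect_lt h').le]

theorem triMap_pull {m n : ℕ} (θ : ⦋m⦌ ⟶ ⦋n⦌) (i j k : Fin (m + 1)) (x : V _⦋n⦌) :
    triMap e₂ i j k (pull V θ x)
      = triMap e₂ (θ.toOrderHom i) (θ.toOrderHom j) (θ.toOrderHom k) x := by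
  by_cases h : i ≤ j ∧ j ≤ k
  · rw [triMap_of_le e₂ h.1 h.2,
      triMap_of_le e₂ (θ.toOrderHom.monotone h.1) (θ.toOrderHom.monotone h.2), pull_pull,
      mkOfLeComp_comp]
  · rw [triMap_eq_zero e₂ fun h' => h ⟨h'.1.le, h'.2.le⟩,
      triMap_eq_zero e₂ fun h' => h ⟨(θ.toOrderHom.monotone.reflect_lt h'.1).le,
        (θ.toOrderHom.monotone.reflect_lt h'.2).le⟩]

variable (hV : IsLinearGroupoid 2 V) (h₁ : ∀ w, e₀ (bdry1 V w) = d₁ (e₁ w))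
  (h₂ : ∀ w, e₁ (bdry2 V w) = d₂ (e₂ w))

/-- The labelling defined by a simplex of `V` and a map of complexes. -/
def labelling (hV : IsLinearGroupoid 2 V) (h₁ : ∀ w, e₀ (bdry1 V w) = d₁ (e₁ w))
    (h₂ : ∀ w, e₁ (bdry2 V w) = d₂ (e₂ w)) (n : ℕ) : V _⦋n⦌ →ₗ[ℝ] cochains d₁ d₂ n where
  toFun x := ⟨(fun i => vertMap e₀ i x, fun i j => edgeMap e₁ i j x,
    fun i j k => triMap e₂ i j k x), by
      refine ⟨fun i j h => edgeMap_eq_zero e₁ h x, fun i j k h => triMap_eq_zero e₂ h x,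
        fun i j h => ?_, fun i j k h h' => ?_, fun i j k l h h' h'' => ?_⟩ <;> dsimp only
      · obtain ⟨δ0, δ1⟩ := δ_mkOfLe i j h
        rw [edgeMap_of_le e₁ h, ← h₁, bdry1_proj1, face_pull, face_pull, δ0, δ1, map_sub]
        rfl
      · obtain ⟨δ0, δ1, δ2⟩ := δ_mkOfLeComp i j k h h'
        rw [triMap_of_le e₂ h h', ← h₂, bdry2_proj2, face_pull, face_pull, face_pull, δ0, δ1, δ2,
          map_sub, map_add, edgeMap_of_le e₁ h, edgeMap_of_le e₁ h', edgeMap_of_le e₁ (h.trans h')]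
      · obtain ⟨δ0, δ1, δ2, δ3⟩ := δ_mkOfLeLeLe i j k l h h' h''
        -- The tetrahedron relation is the only one that needs unique horn filling in `V`.
        have := hV.proj2_cocycle (pull V (mkOfLeLeLe i j k l h h' h'') x)
        rw [face_pull, face_pull, face_pull, face_pull, δ0, δ1, δ2, δ3] at this
        rw [triMap_of_le e₂ h' h'', triMap_of_le e₂ (h.trans h') h'',
          triMap_of_le e₂ h (h'.trans h''), triMap_of_le e₂ h h', ← map_sub, ← map_add, ← map_sub,
          this, map_zero]⟩
  map_add' x y := by
    simp only [map_add]
    rfl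
  map_smul' c x := by
    simp only [map_smul]
    rfl

/-- The map from `V` to the simplicial vector space of a complex that is defined by a map of
complexes. -/
def toCochainVS : V ⟶ cochainVS d₁ d₂ where
  app Δ := ModuleCat.ofHom (labelling e₀ e₁ e₂ hV h₁ h₂ Δ.unop.len)
  naturality Δ Δ' f := by
    ext x
    refine cochain_ext (n := Δ'.unop.len) (fun i => ?_)
      (fun i j => edgeMap_pull (m := Δ'.unop.len) (n := Δ.unop.len) e₁ f.unop i j x)
      fun i j k => triMap_pull (m := Δ'.unop.len) (n := Δ.unop.len) e₂ f.unop i j k x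
    change e₀ (pull V _ (pull V (m := Δ'.unop.len) (n := Δ.unop.len) f.unop x)) = _
    rw [pull_pull]
    rfl

theorem vert_toCochainVS (x : V _⦋0⦌) :
    vert 0 (appLin (toCochainVS e₀ e₁ e₂ hV h₁ h₂) 0 x) = e₀ x := by
  change e₀ (pull V (SimplexCategory.const ⦋0⦌ ⦋0⦌ 0) x) = e₀ x
  rw [Subsingleton.elim (SimplexCategory.const ⦋0⦌ ⦋0⦌ 0) (𝟙 ⦋0⦌)]
  exact congrArg e₀ (congrArg (fun f => f.hom x) (V.map_id (op ⦋0⦌)))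

theorem edge_toCochainVS (w : cplx1 V) :
    edge 0 1 (appLin (toCochainVS e₀ e₁ e₂ hV h₁ h₂) 1 w) = e₁ w := by
  change edgeMap e₁ 0 1 (w : V _⦋1⦌) = _
  rw [edgeMap_of_le e₁ (by decide)]
  have h : SimplexCategory.mkOfLe (n := 1) 0 1 (by decide) = 𝟙 ⦋1⦌ := by
    ext a; fin_cases a <;> rfl
  rw [h]
  have h' : pull V (𝟙 ⦋1⦌) (w : V _⦋1⦌) = w := congrArg (fun f => f.hom w.1) (V.map_id (op ⦋1⦌))
  rw [h', proj1_of_mem]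

theorem tri_toCochainVS (w : cplx2 V) :
    tri 0 1 2 (appLin (toCochainVS e₀ e₁ e₂ hV h₁ h₂) 2 w) = e₂ w := by
  change triMap e₂ 0 1 2 (w : V _⦋2⦌) = _
  rw [triMap_of_le e₂ (by decide) (by decide)]
  have h : SimplexCategory.mkOfLeComp (n := 2) 0 1 2 (by decide) (by decide) = 𝟙 ⦋2⦌ := by
    ext a; fin_cases a <;> rfl
  rw [h]
  have h' : pull V (𝟙 ⦋2⦌) (w : V _⦋2⦌) = w := congrArg (fun f => f.hom w.1) (V.map_id (op ⦋2⦌))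
  rw [h', proj2_of_mem]

end ToCochains

/-! ### Maps that preserve the forms -/

section Preservation

variable {X Y : ConstSymp2Groupoid.{u}}

/-- A map that preserves `C₄₁` and `C₃₂` preserves the 2-forms. -/
theorem map_ω_of_components (f : X.V ⟶ Y.V)
    (h₄₁ : ∀ v w, C41 Y (appLin f 0 v) (cplx2Map f w) = C41 X v w)
    (h₃₂ : ∀ u u', C32 Y (cplx1Map f u) (cplx1Map f u') = C32 X u u') (x y : X.V _⦋2⦌) :
    Y.ω (appLin f 2 x) (appLin f 2 y) = X.ω x y := by
  simp only [C41_eq, C32_eq, cplx1Map_coe, cplx2Map_coe] at h₄₁ h₃₂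
  -- All conditions on the form are linear, so the difference of the two forms is multiplicative,
  -- normalized and alternating, with zero components.
  have key : Y.ω.comp (appLin f 2) (appLin f 2) - X.ω = 0 := by
    refine IsMultiplicative.eq_zero (isMultiplicative_iff.2 fun x y => ?_) (fun i => ?_)
      (fun x => ?_) (fun v w => ?_) fun u u' => ?_
    · have hX := X.isMultiplicative.apply x y
      have hY := Y.isMultiplicative.apply (appLin f 3 x) (appLin f 3 y)
      simp only [face_appLin] at hY
      simp only [LinearMap.sub_apply, LinearMap.BilinForm.comp_apply]
      linear_combination hY - hX
    · refine LinearMap.ext fun x => LinearMap.ext fun y => ?_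
      change Y.ω (appLin f 2 (degen X.V i x)) (appLin f 2 (degen X.V i y))
        - X.ω (degen X.V i x) (degen X.V i y) = 0
      rw [← degen_appLin f (q := 1), ← degen_appLin f (q := 1), Y.isNormalized.apply,
        X.isNormalized.apply, sub_zero]
    · change Y.ω (appLin f 2 x) (appLin f 2 x) - X.ω x x = 0
      rw [Y.isAlt.self_eq_zero, X.isAlt.self_eq_zero, sub_zero]
    · change Y.ω (appLin f 2 (degen X.V (q := 1) 0 (degen X.V (q := 0) 0 v))) (appLin f 2 w.1)
        - X.ω (degen X.V (q := 1) 0 (degen X.V (q := 0) 0 v)) w.1 = 0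
      rw [← degen_appLin f (q := 1), ← degen_appLin f (q := 0), h₄₁, sub_self]
    · change Y.ω (appLin f 2 (degen X.V (q := 1) 1 u.1)) (appLin f 2 (degen X.V (q := 1) 0 u'.1))
        - X.ω (degen X.V (q := 1) 1 u.1) (degen X.V (q := 1) 0 u'.1) = 0
      rw [← degen_appLin f (q := 1), ← degen_appLin f (q := 1), h₃₂, sub_self]
  exact sub_eq_zero.1 (LinearMap.congr_fun (LinearMap.congr_fun key x) y)

theorem SympIso.C41_map (f : SympIso X Y) (v : cplx0 X.V) (w : cplx2 X.V) :
    C41 Y (f.app 0 v) (cplx2Map f.iso.hom w) = C41 X v w := by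
  rw [C41_eq, C41_eq, cplx2Map_coe, degen_appLin f.iso.hom (q := 0),
    degen_appLin f.iso.hom (q := 1)]
  exact f.map_ω _ _

theorem SympIso.C32_map (f : SympIso X Y) (u u' : cplx1 X.V) :
    C32 Y (f.app1 u) (f.app1 u') = C32 X u u' := by
  change C32 Y (cplx1Map f.iso.hom u) (cplx1Map f.iso.hom u') = _
  rw [C32_eq, C32_eq, cplx1Map_coe, cplx1Map_coe, degen_appLin f.iso.hom (q := 1),
    degen_appLin f.iso.hom (q := 1)]
  exact f.map_ω _ _

end Preservation

/-! ### Presentations determine the groupoid -/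

namespace Presentation

variable {X Y : ConstSymp2Groupoid.{u}} {S T : LinearData.{u}}

theorem form_apply (φ : Presentation X S) (u u' : cplx1 X.V) :
    S.form (φ.e₁ u) (φ.e₁ u') = C32 X u u' + C32 X u' u := by
  rw [φ.map_C32, φ.map_C32, S.form_comm (φ.e₁ u'), ← S.r_neg (φ.e₁ u)]
  ring

theorem r_apply (φ : Presentation X S) (u u' : cplx1 X.V) :
    S.r (φ.e₁ u) (φ.e₁ u') = 1 / 2 * (C32 X u u' - C32 X u' u) := by
  rw [φ.map_C32, φ.map_C32, S.form_comm (φ.e₁ u'), ← S.r_neg (φ.e₁ u)]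
  ring

/-- The simplicial map from a presented groupoid to the model. -/
noncomputable def modelMap (φ : Presentation X S) : X.V ⟶ S.model :=
  toCochainVS φ.e₀.toLinearMap φ.e₁.toLinearMap φ.e₂.toLinearMap X.isLinearGroupoid φ.map_bdry1
    φ.map_bdry2

theorem modelEquiv0_modelMap (φ : Presentation X S) (v : cplx0 X.V) :
    S.modelEquiv0 (appLin φ.modelMap 0 v) = φ.e₀ v :=
  vert_toCochainVS φ.e₀.toLinearMap φ.e₁.toLinearMap φ.e₂.toLinearMap X.isLinearGroupoid
    φ.map_bdry1 φ.map_bdry2 v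

theorem modelEquiv1_modelMap (φ : Presentation X S) (w : cplx1 X.V) :
    S.modelEquiv1 (cplx1Map φ.modelMap w) = φ.e₁ w :=
  edge_toCochainVS φ.e₀.toLinearMap φ.e₁.toLinearMap φ.e₂.toLinearMap X.isLinearGroupoid
    φ.map_bdry1 φ.map_bdry2 w

theorem modelEquiv2_modelMap (φ : Presentation X S) (w : cplx2 X.V) :
    S.modelEquiv2 (cplx2Map φ.modelMap w) = φ.e₂ w :=
  tri_toCochainVS φ.e₀.toLinearMap φ.e₁.toLinearMap φ.e₂.toLinearMap X.isLinearGroupoid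
    φ.map_bdry1 φ.map_bdry2 w

/-- On the associated complexes the map is the presentation itself, up to the identifications of the
model. -/
theorem modelMap_bijective (φ : Presentation X S) (q : ℕ) :
    Function.Bijective (appLin φ.modelMap q) := by
  refine bijective_appLin_of_cplx X.isLinearGroupoid isLinearGroupoid_cochainVS _ ?_ ?_ ?_ q
  · rw [← Function.Bijective.of_comp_iff' S.modelEquiv0.bijective]
    exact (funext φ.modelEquiv0_modelMap : _ ∘ _ = φ.e₀) ▸ φ.e₀.bijective
  · rw [← Function.Bijective.of_comp_iff' S.modelEquiv1.bijective]
    exact (funext φ.modelEquiv1_modelMap : _ ∘ _ = φ.e₁) ▸ φ.e₁.bijective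
  · rw [← Function.Bijective.of_comp_iff' S.modelEquiv2.bijective]
    exact (funext φ.modelEquiv2_modelMap : _ ∘ _ = φ.e₂) ▸ φ.e₂.bijective

/-- A presented groupoid is isomorphic to the model. -/
noncomputable def modelIso (φ : Presentation X S) : SympIso X S.groupoid where
  iso := isoOfBijective φ.modelMap φ.modelMap_bijective
  map_ω := map_ω_of_components (Y := S.groupoid) φ.modelMap
    (fun v w => by
      rw [S.presentation.map_C41, φ.map_C41]
      exact congrArg₂ (fun (ξ : Module.Dual ℝ S.W₀) v => ξ v) (φ.modelEquiv2_modelMap w)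
        (φ.modelEquiv0_modelMap v))
    (fun u u' => by
      rw [S.presentation.map_C32, φ.map_C32]
      exact congrArg₂ (fun a b => 1 / 2 * S.form a b + S.r a b) (φ.modelEquiv1_modelMap u)
        (φ.modelEquiv1_modelMap u'))

theorem e₀_modelIso (φ : Presentation X S) (v : cplx0 X.V) :
    S.presentation.e₀ (φ.modelIso.app 0 v) = φ.e₀ v := φ.modelEquiv0_modelMap v

theorem e₁_modelIso (φ : Presentation X S) (w : cplx1 X.V) :
    S.presentation.e₁ (φ.modelIso.app1 w) = φ.e₁ w := φ.modelEquiv1_modelMap w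

end Presentation

/-! ### Composition of isomorphisms -/

namespace SympIso

variable {X Y Z : ConstSymp2Groupoid.{u}}

/-- The inverse of an isomorphism. -/
def symm (f : SympIso X Y) : SympIso Y X where
  iso := f.iso.symm
  map_ω x y := by
    have key : ∀ z : Y.V _⦋2⦌,
        (f.iso.hom.app (op ⦋2⦌)).hom ((f.iso.inv.app (op ⦋2⦌)).hom z) = z := fun z =>
      congrArg (fun g => g.hom z) (f.iso.inv_hom_id_app (op ⦋2⦌))
    have := f.map_ω ((f.iso.inv.app (op ⦋2⦌)).hom x) ((f.iso.inv.app (op ⦋2⦌)).hom y)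
    rw [key, key] at this
    exact this.symm

/-- The composition of isomorphisms. -/
def trans (f : SympIso X Y) (g : SympIso Y Z) : SympIso X Z where
  iso := f.iso ≪≫ g.iso
  map_ω x y := (g.map_ω _ _).trans (f.map_ω x y)

theorem app_symm_app (f : SympIso X Y) (q : ℕ) (y : Y.V _⦋q⦌) : f.app q (f.symm.app q y) = y :=
  congrArg (fun g => g.hom y) (f.iso.inv_hom_id_app (op ⦋q⦌))

theorem symm_app_app (f : SympIso X Y) (q : ℕ) (x : X.V _⦋q⦌) : f.symm.app q (f.app q x) = x :=
  congrArg (fun g => g.hom x) (f.iso.hom_inv_id_app (op ⦋q⦌))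

/-- The linear isomorphism in degree `q`. -/
def appEquiv (f : SympIso X Y) (q : ℕ) : X.V _⦋q⦌ ≃ₗ[ℝ] Y.V _⦋q⦌ :=
  LinearEquiv.ofLinearMap (f.app q) (f.symm.app q) (LinearMap.ext (f.app_symm_app q))
    (LinearMap.ext (f.symm_app_app q))

/-- The linear isomorphism of `W_1`. -/
def app1Equiv (f : SympIso X Y) : cplx1 X.V ≃ₗ[ℝ] cplx1 Y.V :=
  LinearEquiv.ofLinearMap f.app1 f.symm.app1
    (LinearMap.ext fun w => Subtype.ext (f.app_symm_app 1 w.1))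
    (LinearMap.ext fun w => Subtype.ext (f.symm_app_app 1 w.1))

end SympIso

/-! ### Isomorphisms of groupoids and of tuples -/

section Matching

variable {X Y : ConstSymp2Groupoid.{u}} {S T : LinearData.{u}}

/-- `∂^*` is determined by the form and `∂`, both of which `g` preserves. -/
theorem DataIso.map_bdryStar (g : DataIso S T) (η : Module.Dual ℝ T.W₀) :
    g.e₁ (S.bdryStar (η ∘ₗ g.e₀.toLinearMap)) = T.bdryStar η := by
  rw [← sub_eq_zero]
  refine T.form_nondegenerate.1 _ fun u => ?_
  obtain ⟨u, rfl⟩ := g.e₁.surjective u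
  rw [map_sub, LinearMap.sub_apply, g.map_form, S.form_bdryStar, T.form_bdryStar, g.map_bdry]
  exact sub_self _

/-- The transport of a presentation along an isomorphism of tuples. -/
def Presentation.trans (φ : Presentation X S) (g : DataIso S T) : Presentation X T where
  e₀ := φ.e₀.trans g.e₀
  e₁ := φ.e₁.trans g.e₁
  e₂ := φ.e₂.trans g.e₀.symm.dualMap
  map_bdry1 w := by
    change g.e₀ (φ.e₀ _) = T.bdry (g.e₁ (φ.e₁ w))
    rw [φ.map_bdry1, g.map_bdry]
  map_bdry2 w := by
    change g.e₁ (φ.e₁ _) = T.bdryStar (g.e₀.symm.dualMap (φ.e₂ w))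
    rw [φ.map_bdry2, ← g.map_bdryStar]
    congr 2
    ext v
    simp
  map_C41 v w := by
    rw [φ.map_C41]
    simp
  map_C32 u u' := by
    change _ = 1 / 2 * T.form (g.e₁ (φ.e₁ u)) (g.e₁ (φ.e₁ u')) + T.r (g.e₁ (φ.e₁ u)) (g.e₁ (φ.e₁ u'))
    rw [φ.map_C32, g.map_form, g.map_r]

/-- An isomorphism of tuples lifts to an isomorphism of the presented groupoids. -/
theorem exists_sympIso_matches (φ : Presentation X S) (ψ : Presentation Y T) (g : DataIso S T) :
    ∃ f : SympIso X Y, Matches φ ψ f g := by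
  -- After transport along `g`, both groupoids are presented by `T`; compare them through the model
  -- of `T`.
  set χ := φ.trans g
  refine ⟨χ.modelIso.trans ψ.modelIso.symm, fun x => ?_, fun w => ?_⟩
  · rw [← ψ.e₀_modelIso]
    change T.presentation.e₀ (ψ.modelIso.app 0 (ψ.modelIso.symm.app 0 (χ.modelIso.app 0 x))) = _
    rw [SympIso.app_symm_app, χ.e₀_modelIso]
    rfl
  · rw [← ψ.e₁_modelIso]
    have h : ψ.modelIso.app1 ((χ.modelIso.trans ψ.modelIso.symm).app1 w) = χ.modelIso.app1 w :=
      Subtype.ext (ψ.modelIso.app_symm_app 1 _)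
    rw [h, χ.e₁_modelIso]
    rfl

/-- Matching fixes `f` on `W_0` and `W_1`. On `W_2` it is fixed by invariance of the perfect pairing
C₄₁, on degenerate parts by naturality, and above degree 2 by horn uniqueness. -/
theorem Matches.sympIso_unique {φ : Presentation X S} {ψ : Presentation Y T} {f f' : SympIso X Y}
    {g : DataIso S T} (h : Matches φ ψ f g) (h' : Matches φ ψ f' g) : f = f' := by
  have a₀ : ∀ x, f.app 0 x = f'.app 0 x := fun x =>
    ψ.e₀.injective ((h.1 x).trans (h'.1 x).symm)
  have w₁ : ∀ w : cplx1 X.V, f.app 1 w = f'.app 1 w := fun w =>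
    congrArg Subtype.val (ψ.e₁.injective ((h.2 w).trans (h'.2 w).symm))
  have a₁ : ∀ x, f.app 1 x = f'.app 1 x := fun x => by
    rw [eq_proj1_add X.V x, map_add, map_add, w₁]
    congr 1
    exact (degen_appLin f.iso.hom (q := 0) 0 _).symm.trans
      ((congrArg _ (a₀ _)).trans (degen_appLin f'.iso.hom (q := 0) 0 _))
  have w₂ : ∀ w : cplx2 X.V, f.app 2 w = f'.app 2 w := fun w => by
    have : cplx2Map f.iso.hom w = cplx2Map f'.iso.hom w := by
      refine ψ.e₂.injective (LinearMap.ext fun v => ?_)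
      obtain ⟨v, rfl⟩ := ψ.e₀.surjective v
      obtain ⟨v, rfl⟩ := (f.appEquiv 0).surjective v
      change ψ.e₂ _ (ψ.e₀ (f.app 0 v)) = ψ.e₂ _ (ψ.e₀ (f.app 0 v))
      rw [← ψ.map_C41, f.C41_map, a₀, ← ψ.map_C41, f'.C41_map]
    exact congrArg Subtype.val this
  have a₂ : ∀ x, f.app 2 x = f'.app 2 x := fun x => by
    have hd : ∀ (i : Fin 2) (y : X.V _⦋1⦌),
        f.app 2 (degen X.V (q := 1) i y) = f'.app 2 (degen X.V (q := 1) i y) := fun i y =>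
      (degen_appLin f.iso.hom (q := 1) i y).symm.trans
        ((congrArg _ (a₁ y)).trans (degen_appLin f'.iso.hom (q := 1) i y))
    rw [eq_proj2_add X.V x, map_add, map_add, map_add, map_add, w₂, hd, hd]
  refine SympIso.ext (Iso.ext (hom_ext_of_le Y.isLinearGroupoid fun q hq => ?_))
  interval_cases q
  exacts [LinearMap.ext a₀, LinearMap.ext a₁, LinearMap.ext a₂]

/-- The isomorphism of tuples induced by an isomorphism of presented groupoids. -/
def SympIso.toDataIso (φ : Presentation X S) (ψ : Presentation Y T) (f : SympIso X Y) :
    DataIso S T where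
  e₁ := φ.e₁.symm.trans (f.app1Equiv.trans ψ.e₁)
  e₀ := φ.e₀.symm.trans ((f.appEquiv 0).trans ψ.e₀)
  map_form x y := by
    obtain ⟨x, rfl⟩ := φ.e₁.surjective x
    obtain ⟨y, rfl⟩ := φ.e₁.surjective y
    simp only [LinearEquiv.trans_apply, LinearEquiv.symm_apply_apply]
    rw [ψ.form_apply, φ.form_apply]
    exact congrArg₂ (· + ·) (f.C32_map _ _) (f.C32_map _ _)
  map_bdry x := by
    obtain ⟨x, rfl⟩ := φ.e₁.surjective x
    rw [← φ.map_bdry1]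
    simp only [LinearEquiv.trans_apply, LinearEquiv.symm_apply_apply]
    rw [← ψ.map_bdry1]
    exact congrArg ψ.e₀ (bdry1_cplx1Map f.iso.hom x)
  map_r x y := by
    obtain ⟨x, rfl⟩ := φ.e₁.surjective x
    obtain ⟨y, rfl⟩ := φ.e₁.surjective y
    simp only [LinearEquiv.trans_apply, LinearEquiv.symm_apply_apply]
    rw [ψ.r_apply, φ.r_apply]
    exact congrArg (1 / 2 * ·) (congrArg₂ (· - ·) (f.C32_map _ _) (f.C32_map _ _))

theorem SympIso.matches_toDataIso (φ : Presentation X S) (ψ : Presentation Y T)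
    (f : SympIso X Y) : Matches φ ψ f (f.toDataIso φ ψ) :=
  ⟨fun x => (congrArg (fun y => ψ.e₀ (f.app 0 y)) (φ.e₀.symm_apply_apply x)).symm,
    fun w => (congrArg (fun y => ψ.e₁ (f.app1 y)) (φ.e₁.symm_apply_apply w)).symm⟩

theorem Matches.dataIso_unique {φ : Presentation X S} {ψ : Presentation Y T} {f : SympIso X Y}
    {g g' : DataIso S T} (h : Matches φ ψ f g) (h' : Matches φ ψ f g') : g = g' := by
  refine DataIso.ext (LinearEquiv.ext fun x => ?_) (LinearEquiv.ext fun x => ?_)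
  · obtain ⟨x, rfl⟩ := φ.e₁.surjective x
    rw [← h.2, ← h'.2]
  · obtain ⟨x, rfl⟩ := φ.e₀.surjective x
    rw [← h.1, ← h'.1]

end Matching

/-! ### The tuple of a constant symplectic 2-groupoid -/

namespace ConstSymp2Groupoid

variable (X : ConstSymp2Groupoid.{u})

instance (q : ℕ) : FiniteDimensional ℝ (X.V _⦋q⦌) := X.isLinearGroupoid.finiteDimensional q

/-- The bilinear form `C₃₂`. -/
def c32 : LinearMap.BilinForm ℝ (cplx1 X.V) :=
  X.ω.compl₁₂ (degen X.V (q := 1) 1 ∘ₗ (cplx1 X.V).subtype)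
    (degen X.V (q := 1) 0 ∘ₗ (cplx1 X.V).subtype)

theorem c32_apply (u u' : cplx1 X.V) : X.c32 u u' = C32 X u u' := (C32_eq X u u').symm

/-- The symmetric form on `W_1`. -/
def symForm : LinearMap.BilinForm ℝ (cplx1 X.V) := X.c32 + X.c32.flip

theorem symForm_apply (u u' : cplx1 X.V) : X.symForm u u' = C32 X u u' + C32 X u' u := by
  rw [← c32_apply, ← c32_apply]
  rfl

theorem symForm_comm (u u' : cplx1 X.V) : X.symForm u u' = X.symForm u' u := by
  rw [symForm_apply, symForm_apply, add_comm]

/-- Each class modulo degenerate vectors has a representative in `W_1`, so `B_ω` is `symForm`;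
likewise `A_ω` is C₄₁ below. -/
theorem pairingB_mk_proj1 (x y : X.V _⦋1⦌) :
    pairingB X.V X.ω X.isNormalized (Submodule.Quotient.mk x) (Submodule.Quotient.mk y)
      = X.symForm (proj1 X.V x) (proj1 X.V y) := by
  have h : ∀ z : X.V _⦋1⦌, (Submodule.Quotient.mk z : NormalizedTangent X.V 0)
      = Submodule.Quotient.mk (proj1 X.V z : X.V _⦋1⦌) := fun z =>
    (Submodule.Quotient.eq _).2 (proj1_mem_degenerate X.V z)
  rw [h x, h y, pairingB_mk, symForm_apply, C32_eq, C32_eq]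

theorem pairingA_mk_proj2 (v : X.V _⦋0⦌) (y : X.V _⦋2⦌) :
    pairingA X.V X.ω X.isNormalized v (Submodule.Quotient.mk y) = C41 X v (proj2 X.V y) := by
  have h : (Submodule.Quotient.mk y : NormalizedTangent X.V 1)
      = Submodule.Quotient.mk (proj2 X.V y : X.V _⦋2⦌) :=
    (Submodule.Quotient.eq _).2 (proj2_mem_degenerate X.V y)
  rw [h, pairingA_mk, C41_eq]

theorem proj1_eq_zero_of_degenerate (V : SimplicialVS.{u}) {x : V _⦋1⦌} (hx : x ∈ degenerate V 0) :
    proj1 V x = 0 := by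
  have h : degenerate V 0 ≤ LinearMap.ker (proj1 V) := iSup_le fun i => by
    rintro _ ⟨y, rfl⟩
    fin_cases i
    exact proj1_degen V y
  exact h hx

theorem proj2_eq_zero_of_degenerate (V : SimplicialVS.{u}) {x : V _⦋2⦌} (hx : x ∈ degenerate V 1) :
    proj2 V x = 0 := by
  have h : degenerate V 1 ≤ LinearMap.ker (proj2 V) := iSup_le fun i => by
    rintro _ ⟨y, rfl⟩
    fin_cases i
    exacts [proj2_degen_zero V y, proj2_degen_one V y]
  exact h hx

theorem symForm_nondegenerate : X.symForm.Nondegenerate := by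
  have left : X.symForm.SeparatingLeft := by
    intro u hu
    have h : (Submodule.Quotient.mk u.1 : NormalizedTangent X.V 0) = 0 := by
      refine X.nondegenerate_B.1 _ fun y => ?_
      obtain ⟨y, rfl⟩ := Submodule.Quotient.mk_surjective _ y
      rw [pairingB_mk_proj1, proj1_of_mem]
      exact hu _
    rw [← proj1_of_mem X.V u]
    exact proj1_eq_zero_of_degenerate X.V ((Submodule.Quotient.mk_eq_zero _).1 h)
  exact ⟨left, fun u hu => left u fun u' => by rw [symForm_comm, hu]⟩

/-- The pairing `C₄₁` as a map from `W_2` to the dual of `W_0`. -/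
def toDual : cplx2 X.V →ₗ[ℝ] Module.Dual ℝ (cplx0 X.V) :=
  (preA X.V X.ω).flip ∘ₗ (cplx2 X.V).subtype

theorem toDual_apply (w : cplx2 X.V) (v : cplx0 X.V) : X.toDual w v = C41 X v w :=
  (C41_eq X v w).symm

theorem toDual_injective : Function.Injective X.toDual := by
  rw [injective_iff_map_eq_zero]
  intro w hw
  have h : (Submodule.Quotient.mk w.1 : NormalizedTangent X.V 1) = 0 := by
    refine X.nondegenerate_A.2 _ fun v => ?_
    rw [pairingA_mk_proj2, proj2_of_mem, ← toDual_apply, hw, LinearMap.zero_apply]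
  rw [← proj2_of_mem X.V w]
  exact proj2_eq_zero_of_degenerate X.V ((Submodule.Quotient.mk_eq_zero _).1 h)

theorem toDual_flip_injective : Function.Injective X.toDual.flip := by
  rw [injective_iff_map_eq_zero]
  intro v hv
  refine X.nondegenerate_A.1 _ fun y => ?_
  obtain ⟨y, rfl⟩ := Submodule.Quotient.mk_surjective _ y
  rw [pairingA_mk_proj2, ← toDual_apply]
  exact LinearMap.congr_fun hv _

/-- In finite dimension a pairing injective on both sides is perfect. -/
theorem toDual_bijective : Function.Bijective X.toDual := by
  have := LinearMap.IsPerfPair.of_injective X.toDual_injective X.toDual_flip_injective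
  exact LinearMap.IsPerfPair.bijective_left X.toDual

/-- The isomorphism of `W_2` with the dual of `W_0`. -/
noncomputable def dualEquiv : cplx2 X.V ≃ₗ[ℝ] Module.Dual ℝ (cplx0 X.V) :=
  LinearEquiv.ofBijective X.toDual X.toDual_bijective

theorem bdry1_bdry2 (w : cplx2 X.V) : bdry1 X.V (bdry2 X.V w) = 0 := by
  change -(face X.V (q := 0) 1 (face X.V (q := 1) 2 w.1)) = 0
  rw [face_face_1_1_2, face_one_of_mem₂, map_zero, neg_zero]

/-- The three multiplicativity identities, with skew symmetry, reduce the left side to `ω(w, σ_0 u)`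
and then to `-ω(w, σ_0 σ_0 ∂_1 u)`. This adjointness forces `∂_2 = ∂^*`. -/
theorem symForm_bdry2 (w : cplx2 X.V) (u : cplx1 X.V) :
    X.symForm (bdry2 X.V w) u = C41 X (bdry1 X.V u) w := by
  have h₀ := X.isMultiplicative.apply_two_degen_zero w u
  have h₁ := X.isMultiplicative.apply_two_degen_one w u
  have h := X.isMultiplicative.apply_bdry2_degen w u
  have e₀ := X.isAlt.neg_eq w.1 (degen X.V (q := 1) 0 (degen X.V (q := 0) 0 (bdry1 X.V u)))
  have e₁ := X.isAlt.neg_eq (degen X.V (q := 1) 0 (bdry2 X.V w).1) (degen X.V (q := 1) 1 u.1)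
  rw [symForm_apply, C41_eq, C32_eq, C32_eq, ← e₀, ← e₁]
  linarith

theorem adjointMap_dualEquiv (w : cplx2 X.V) :
    adjointMap X.symForm X.symForm_nondegenerate (bdry1 X.V) (X.dualEquiv w) = bdry2 X.V w := by
  rw [← sub_eq_zero]
  refine X.symForm_nondegenerate.1 _ fun u => ?_
  rw [map_sub, LinearMap.sub_apply, form_adjointMap, symForm_bdry2]
  exact sub_eq_zero.2 (X.toDual_apply w _)

/-- The tuple of a constant symplectic 2-groupoid. -/
noncomputable def toLinearData : LinearData.{u} where
  W₁ := cplx1 X.V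
  W₀ := cplx0 X.V
  form := X.symForm
  form_symm := ⟨X.symForm_comm⟩
  form_nondegenerate := X.symForm_nondegenerate
  bdry := bdry1 X.V
  isotropic := by
    rintro _ ⟨ξ, rfl⟩ _ ⟨η, rfl⟩
    -- With `η` coming from `w`, `⟨∂^* ξ, ∂^* η⟩ = ξ (∂_1 ∂_2 w) = 0`.
    obtain ⟨w, rfl⟩ := X.dualEquiv.surjective η
    rw [form_adjointMap, adjointMap_dualEquiv, bdry1_bdry2, map_zero]
  r := (1 / 2 : ℝ) • (X.c32 - X.c32.flip)
  r_isAlt u := by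
    change (1 / 2 : ℝ) * (X.c32 u u - X.c32 u u) = 0
    rw [sub_self, mul_zero]

/-- The presentation of a constant symplectic 2-groupoid by its tuple. -/
noncomputable def toPresentation : Presentation X X.toLinearData where
  e₀ := LinearEquiv.refl ℝ _
  e₁ := LinearEquiv.refl ℝ _
  e₂ := X.dualEquiv
  map_bdry1 _ := rfl
  map_bdry2 w := (X.adjointMap_dualEquiv w).symm
  map_C41 v w := (X.toDual_apply w v).symm
  map_C32 u u' := by
    change _ = 1 / 2 * X.symForm u u' + (1 / 2 : ℝ) * (X.c32 u u' - X.c32 u' u)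
    rw [symForm_apply, c32_apply, c32_apply]
    ring

end ConstSymp2Groupoid

/-! ### The bijection on isomorphism classes. -/

/-- The tuple of a constant symplectic 2-groupoid, up to isomorphism. -/
noncomputable def classMap : Quotient sympSetoid.{u} → Quotient dataSetoid.{u} :=
  Quotient.map ConstSymp2Groupoid.toLinearData fun X Y ⟨f⟩ =>
    ⟨f.toDataIso X.toPresentation Y.toPresentation⟩

theorem classMap_eq_iff (X : ConstSymp2Groupoid.{u}) (T : LinearData.{u}) :
    classMap (Quotient.mk _ X) = Quotient.mk _ T ↔ Nonempty (Presentation X T) := by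
  constructor
  · intro h
    obtain ⟨g⟩ : Nonempty (DataIso X.toLinearData T) := Quotient.exact h
    exact ⟨X.toPresentation.trans g⟩
  · rintro ⟨φ⟩
    -- The identity of `X`, read in its two presentations, is an isomorphism of their tuples.
    exact Quotient.sound (s := dataSetoid)
      ⟨(⟨Iso.refl _, fun _ _ => rfl⟩ : SympIso X X).toDataIso X.toPresentation φ⟩

theorem classMap_bijective : Function.Bijective classMap.{u} := by
  constructor
  · intro a b
    induction a using Quotient.inductionOn with
    | _ X =>
    induction b using Quotient.inductionOn with
    | _ Y =>
    intro h
    obtain ⟨g⟩ : Nonempty (DataIso X.toLinearData Y.toLinearData) := Quotient.exact h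
    obtain ⟨f, -⟩ := exists_sympIso_matches X.toPresentation Y.toPresentation g
    exact Quotient.sound (s := sympSetoid) ⟨f⟩
  · intro b
    induction b using Quotient.inductionOn with
    | _ T => exact ⟨Quotient.mk _ T.groupoid, (classMap_eq_iff _ _).2 ⟨T.presentation⟩⟩

end ConstSymplectic

theorem theorem3p5 :
    (∃ Φ : Quotient ConstSymplectic.sympSetoid.{u} ≃ Quotient ConstSymplectic.dataSetoid.{u},
      ∀ (X : ConstSymplectic.ConstSymp2Groupoid.{u}) (T : ConstSymplectic.LinearData.{u}),
        Φ (Quotient.mk _ X) = Quotient.mk _ T ↔ Nonempty (ConstSymplectic.Presentation X T)) ∧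
    ∀ (X Y : ConstSymplectic.ConstSymp2Groupoid.{u}) (S T : ConstSymplectic.LinearData.{u})
      (φ : ConstSymplectic.Presentation X S) (ψ : ConstSymplectic.Presentation Y T),
      (∀ g : ConstSymplectic.DataIso S T,
        ∃! f : ConstSymplectic.SympIso X Y, ConstSymplectic.Matches φ ψ f g) ∧
      (∀ f : ConstSymplectic.SympIso X Y,
        ∃! g : ConstSymplectic.DataIso S T, ConstSymplectic.Matches φ ψ f g) := by
  refine ⟨⟨Equiv.ofBijective _ ConstSymplectic.classMap_bijective,
    ConstSymplectic.classMap_eq_iff⟩, fun X Y S T φ ψ => ⟨fun g => ?_, fun f => ?_⟩⟩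
  · obtain ⟨f, hf⟩ := ConstSymplectic.exists_sympIso_matches φ ψ g
    exact ⟨f, hf, fun f' hf' => hf'.sympIso_unique hf⟩
  · exact ⟨f.toDataIso φ ψ, f.matches_toDataIso φ ψ,
      fun g' hg' => hg'.dataIso_unique (f.matches_toDataIso φ ψ)⟩
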